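/- Let $d\ge 1$ and consider Minkowski space $\mathcal M=\mathbb R\times\mathbb R^d$ with points $(t,x)$, coordinates $x^0=t,x^1,\dots,x^d$, partial derivatives $\partial_l=\partial/\partial x^l$, and wave operator $\square=-\partial_0^2+\sum_{i=1}^d\partial_i^2$. Let $|x|$ be the Euclidean norm, and set $$\mathcal E=\{(t,x)\in\mathcal M:\ |x|>|t|+1\},\qquad \mathcal H=\partial\mathcal E=\{(t,x)\in\mathcal M:\ |x|=|t|+1\}.$$ Let $\phi\in C^2(\mathcal M)$ and $A,B^0,\dots,B^d\in C^0(\mathcal M)$ be real- or complex-valued functions (no global bounds on $A,B^l$ are assumed) such that $$\square\phi=A\,\phi+\sum_{l=0}^dB^l\,\partial_l\phi\quad\text{on }\mathcal E .$$ If $\phi\equiv0$ on $\mathcal H$, then $\phi\equiv0$ on $\overline{\mathcal E}=\mathcal E\cup\mathcal H$. No vanishing of the derivatives of $\phi$ on $\mathcal H$ is assumed. -/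

import Mathlib

namespace Minkowski

/-- The space-time `ℝ × ℝᵈ`, with points `p = (t, x)`; `ℝᵈ` carries the Euclidean norm. -/
abbrev Spacetime (d : ℕ) : Type := ℝ × EuclideanSpace ℝ (Fin d)

/-- The coordinate directions: index `0` is the time direction, index `i + 1` is the `i`-th
space direction. -/
noncomputable def basisVec (d : ℕ) : Fin (d + 1) → Spacetime d :=
  Fin.cons ((1 : ℝ), (0 : EuclideanSpace ℝ (Fin d)))
    (fun i : Fin d => ((0 : ℝ), EuclideanSpace.single i (1 : ℝ)))

/-- The coordinate partial derivative `∂_l f`, `l = 0, …, d`. -/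
noncomputable def pderiv {d : ℕ} {𝕜 : Type*} [RCLike 𝕜] (l : Fin (d + 1))
    (f : Spacetime d → 𝕜) : Spacetime d → 𝕜 :=
  fun p => fderiv ℝ f p (basisVec d l)

/-- The wave operator `□ f = -∂_t² f + ∑_{i=1}^d ∂_i² f`. -/
noncomputable def box {d : ℕ} {𝕜 : Type*} [RCLike 𝕜]
    (f : Spacetime d → 𝕜) : Spacetime d → 𝕜 :=
  fun p => -pderiv 0 (pderiv 0 f) p + ∑ i : Fin d, pderiv i.succ (pderiv i.succ f) p

/-- The exterior region `{|x| > |t| + 1}`. -/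
def exterior (d : ℕ) : Set (Spacetime d) := {p | |p.1| + 1 < ‖p.2‖}

/-- The bifurcate characteristic hypersurface `{|x| = |t| + 1}`. -/
def horizon (d : ℕ) : Set (Spacetime d) := {p | ‖p.2‖ = |p.1| + 1}

end Minkowski

open Set Filter Topology MeasureTheory

namespace Minkowski

/-! The horizon is characteristic, so the equation itself supplies the missing Cauchy data there; a
Carleman estimate then propagates the vanishing across the levels of a pseudoconvex function.

On the horizon the tangential derivatives of φ vanish, which leaves the single unknown ∂_t φ. There
□φ involves second derivatives only through the derivative of ∂_t φ along the null generators
(`box_eq_transport`), so the equation becomes a homogeneous linear transport law on each generator.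
At the sphere t = 0, |x| = 1 the tangent directions of the two halves together force ∂_t φ = 0
(`pderiv_corner`), and Gronwall carries this along the generators (`pderiv_eq_zero_of_mem_horizon`).

For the exterior, let f = |x|² - a t² with a slightly above 1, and conjugate by exp(-λΦ), Φ =
-e^{-3f}/3. The multiplier ∇f·∂ψ + (d - 1)ψ yields the definite bulk term (a - 1)|∂ψ|², and the
convexification Φ of f yields a definite λ²ψ² term (`sum_pderiv_current_le`); for large λ these
absorb the lower-order terms (`carleman_pointwise`). There are no boundary terms: on the horizon the
current is quadratic in data that vanish, and for (a - 1)T = 1/2 one has f ≥ 1 + 3T/2 on the lids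
|t| = T, where a cutoff in f is already zero. The weight is larger on f ≤ R than on f ≥ R + 1, where
the cutoff varies, so λ → ∞ forces φ = 0 on f ≤ R (`exists_setIntegral_le`).

Each point of the exterior lies in such a region for suitable T and R. Everything happens on a
compact set, so local bounds on A and B suffice. Only a differential inequality is used, for a
finite real system; this covers complex φ through its real and imaginary parts. -/

/-! ### Divergence theorem without boundary regularity. -/

/-- At a frontier point the truncated function is dominated by `W`, which is o(|x - p|) there.
Extension by zero thus stays differentiable, whatever corners the frontier has. -/
theorem hasFDerivAt_indicator_of_frontier {E : Type*} [NormedAddCommGroup E] [NormedSpace ℝ E]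
    {Ω : Set E} (hΩ : IsOpen Ω) {W : E → ℝ} (hW : Differentiable ℝ W)
    (h0 : ∀ p ∈ frontier Ω, W p = 0 ∧ fderiv ℝ W p = 0) (p : E) :
    HasFDerivAt (Ω.indicator W) (Ω.indicator (fderiv ℝ W) p) p := by
  by_cases hp : p ∈ Ω
  · rw [indicator_of_mem hp]
    refine (hW p).hasFDerivAt.congr_of_eventuallyEq ?_
    filter_upwards [hΩ.mem_nhds hp] with x hx
    exact indicator_of_mem hx _
  rw [indicator_of_notMem hp]
  by_cases hc : p ∈ closure Ω
  · have hf : p ∈ frontier Ω := by rw [hΩ.frontier_eq]; exact ⟨hc, hp⟩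
    obtain ⟨h1, h2⟩ := h0 p hf
    have := (hW p).hasFDerivAt
    rw [h2, hasFDerivAt_iff_isLittleO] at this
    rw [hasFDerivAt_iff_isLittleO]
    refine Asymptotics.IsBigO.trans_isLittleO (Asymptotics.IsBigO.of_bound 1 ?_) this
    refine Eventually.of_forall fun x => ?_
    by_cases hx : x ∈ Ω <;> simp [hx, hp, h1]
  · refine (hasFDerivAt_const (0 : ℝ) p).congr_of_eventuallyEq ?_
    filter_upwards [isClosed_closure.isOpen_compl.mem_nhds hc] with x hx
    exact indicator_of_notMem (fun h => hx (subset_closure h)) _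

/-- The divergence theorem on an open set, for a function that vanishes to second order on the
frontier. -/
theorem setIntegral_fderiv_eq_zero {E : Type*} [NormedAddCommGroup E] [NormedSpace ℝ E]
    [FiniteDimensional ℝ E] [MeasurableSpace E] [BorelSpace E] {μ : Measure E}
    [μ.IsAddHaarMeasure] {Ω K : Set E} (hΩ : IsOpen Ω) (hK : IsCompact K) {W : E → ℝ}
    (hW : ContDiff ℝ 1 W) (h0 : ∀ p ∈ frontier Ω, W p = 0 ∧ fderiv ℝ W p = 0)
    (hWK : ∀ p ∈ Ω, p ∉ K → W p = 0) (v : E) :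
    IntegrableOn (fun p => fderiv ℝ W p v) Ω μ ∧ ∫ p in Ω, fderiv ℝ W p v ∂μ = 0 := by
  have hd := hasFDerivAt_indicator_of_frontier hΩ (hW.differentiable one_ne_zero) h0
  have hcd : Continuous fun p => fderiv ℝ W p v :=
    (hW.continuous_fderiv one_ne_zero).clm_apply continuous_const
  have hdK : ∀ p ∈ Ω, p ∉ K → fderiv ℝ W p v = 0 := by
    intro p hp hpK
    have : W =ᶠ[𝓝 p] fun _ => 0 := by
      filter_upwards [hΩ.mem_nhds hp, hK.isClosed.isOpen_compl.mem_nhds hpK] with x h1 h2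
      exact hWK x h1 h2
    rw [this.fderiv_eq]; simp
  have key : ∀ g : E → ℝ, Continuous g → (∀ p ∈ Ω, p ∉ K → g p = 0) →
      IntegrableOn g Ω μ := by
    intro g hg hgK
    rw [← integrable_indicator_iff hΩ.measurableSet]
    have : Ω.indicator g = Ω.indicator (K.indicator g) := by
      ext p
      by_cases hp : p ∈ Ω <;> by_cases hpK : p ∈ K <;> simp [hp, hpK]
      exact hgK p hp hpK
    rw [this]
    exact ((hg.continuousOn.integrableOn_compact hK).integrable_indicator
      hK.measurableSet).indicator hΩ.measurableSet
  have i1 := key W hW.continuous hWK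
  have i2 := key _ hcd hdK
  refine ⟨i2, ?_⟩
  have e : ∀ p, Ω.indicator (fderiv ℝ W) p v = Ω.indicator (fun p => fderiv ℝ W p v) p := by
    intro p; by_cases hp : p ∈ Ω <;> simp [hp]
  -- Integration by parts on the whole space against the constant 1.
  have := integral_mul_fderiv_eq_neg_fderiv_mul_of_integrable (μ := μ) (𝕜 := ℝ) (v := v)
    (f := fun _ : E => (1 : ℝ)) (g := Ω.indicator W) (by simp)
    (by
      simp only [one_mul, (hd _).fderiv, e]
      exact (integrable_indicator_iff hΩ.measurableSet).2 i2)
    (by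
      simp only [one_mul]
      exact (integrable_indicator_iff hΩ.measurableSet).2 i1)
    (fun _ _ => differentiableAt_const _) (fun p _ => (hd p).differentiableAt)
  simp only [one_mul, (hd _).fderiv, e] at this
  rw [integral_indicator hΩ.measurableSet] at this
  simpa using this

/-! ### Coordinates and partial derivatives. -/

variable {d : ℕ}

/-- The signature of the Minkowski metric. -/
noncomputable def sig (d : ℕ) : Fin (d + 1) → ℝ := Fin.cons (-1) (fun _ => 1)

theorem sig_mul_self (l : Fin (d + 1)) : sig d l * sig d l = 1 := by
  refine Fin.cases ?_ (fun i => ?_) l <;> simp [sig]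

/-- The coordinate functions as continuous linear forms. -/
noncomputable def coord (d : ℕ) : Fin (d + 1) → (Spacetime d →L[ℝ] ℝ) :=
  Fin.cons (ContinuousLinearMap.fst ℝ ℝ _)
    (fun i => (EuclideanSpace.proj i).comp (ContinuousLinearMap.snd ℝ ℝ _))

@[simp] theorem coord_zero (p : Spacetime d) : coord d 0 p = p.1 := rfl

@[simp] theorem coord_succ (i : Fin d) (p : Spacetime d) : coord d i.succ p = p.2 i := rfl

theorem coord_basisVec (k l : Fin (d + 1)) :
    coord d k (basisVec d l) = if l = k then 1 else 0 := by
  refine Fin.cases ?_ (fun i => ?_) k <;> refine Fin.cases ?_ (fun j => ?_) l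
  · simp [basisVec]
  · simp [basisVec, Fin.succ_ne_zero]
  · simp [basisVec, (Fin.succ_ne_zero _).symm]
  · simp [basisVec, Fin.succ_inj, eq_comm]

theorem box_eq_sum {𝕜 : Type*} [RCLike 𝕜] (f : Spacetime d → 𝕜) (p : Spacetime d) :
    box f p = ∑ l, (sig d l : 𝕜) * pderiv l (pderiv l f) p := by
  simp [box, Fin.sum_univ_succ, sig]

theorem sum_coord_smul_basisVec (p : Spacetime d) : ∑ l, coord d l p • basisVec d l = p := by
  rw [Fin.sum_univ_succ]
  refine Prod.ext ?_ ?_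
  · simp [basisVec, Prod.fst_sum]
  · ext i
    simp [basisVec, Prod.snd_sum, Pi.single_apply]

section pderiv

variable {f g : Spacetime d → ℝ} {p : Spacetime d} (l : Fin (d + 1))

theorem pderiv_add (hf : DifferentiableAt ℝ f p) (hg : DifferentiableAt ℝ g p) :
    pderiv l (fun x => f x + g x) p = pderiv l f p + pderiv l g p := by
  simp [pderiv, fderiv_fun_add hf hg]

theorem pderiv_sub (hf : DifferentiableAt ℝ f p) (hg : DifferentiableAt ℝ g p) :
    pderiv l (fun x => f x - g x) p = pderiv l f p - pderiv l g p := by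
  simp [pderiv, fderiv_fun_sub hf hg]

theorem pderiv_mul (hf : DifferentiableAt ℝ f p) (hg : DifferentiableAt ℝ g p) :
    pderiv l (fun x => f x * g x) p = pderiv l f p * g p + f p * pderiv l g p := by
  simp [pderiv, fderiv_fun_mul hf hg]; ring

theorem pderiv_const_mul (c : ℝ) (hf : DifferentiableAt ℝ f p) :
    pderiv l (fun x => c * f x) p = c * pderiv l f p := by
  simp [pderiv, fderiv_const_mul hf]

theorem pderiv_sq (hf : DifferentiableAt ℝ f p) :
    pderiv l (fun x => f x ^ 2) p = 2 * f p * pderiv l f p := by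
  simp [pderiv, fderiv_fun_pow 2 hf]

theorem pderiv_sum {ι : Type*} (s : Finset ι) {F : ι → Spacetime d → ℝ}
    (hF : ∀ i ∈ s, DifferentiableAt ℝ (F i) p) :
    pderiv l (fun x => ∑ i ∈ s, F i x) p = ∑ i ∈ s, pderiv l (F i) p := by
  simp [pderiv, fderiv_fun_sum hF]

theorem pderiv_comp {F : ℝ → ℝ} {F' : ℝ} (hF : HasDerivAt F F' (f p))
    (hf : DifferentiableAt ℝ f p) :
    pderiv l (fun x => F (f x)) p = F' * pderiv l f p := by
  have := (hF.comp_hasFDerivAt p hf.hasFDerivAt).fderiv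
  simp only [Function.comp_def] at this
  simp [pderiv, this]

theorem pderiv_coord (k : Fin (d + 1)) :
    pderiv l (fun x => coord d k x) p = if l = k then 1 else 0 := by
  rw [pderiv, (coord d k).fderiv, coord_basisVec]

end pderiv

theorem contDiff_pderiv {𝕜 : Type*} [RCLike 𝕜] {n : WithTop ℕ∞} {m : WithTop ℕ∞}
    {f : Spacetime d → 𝕜} (hf : ContDiff ℝ n f) (hmn : m + 1 ≤ n) (l : Fin (d + 1)) :
    ContDiff ℝ m (pderiv l f) :=
  (hf.fderiv_right hmn).clm_apply contDiff_const

theorem pderiv_comm {𝕜 : Type*} [RCLike 𝕜] {f : Spacetime d → 𝕜} (hf : ContDiff ℝ 2 f)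
    (k l : Fin (d + 1)) (p : Spacetime d) :
    pderiv k (pderiv l f) p = pderiv l (pderiv k f) p := by
  have hd : DifferentiableAt ℝ (fderiv ℝ f) p :=
    (hf.fderiv_right (m := 1) (by norm_num)).differentiable one_ne_zero p
  have e : ∀ v w, fderiv ℝ (fun x => fderiv ℝ f x v) p w = fderiv ℝ (fderiv ℝ f) p w v := by
    intro v w
    rw [fderiv_clm_apply hd (differentiableAt_const _)]
    simp
  have hs : IsSymmSndFDerivAt ℝ f p := hf.contDiffAt.isSymmSndFDerivAt (by simp)
  unfold pderiv
  rw [e, e]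
  exact hs _ _

/-! ### The multiplier current and its divergence. -/

/-- The Minkowski gradient of the quadratic form `∑ b_l (x^l)²`. -/
noncomputable def quadGrad (b : Fin (d + 1) → ℝ) (l : Fin (d + 1)) (p : Spacetime d) : ℝ :=
  2 * sig d l * b l * coord d l p

/-- The derivative along the vector field `quadGrad b`. -/
noncomputable def along (b : Fin (d + 1) → ℝ) (f : Spacetime d → ℝ) (p : Spacetime d) : ℝ :=
  ∑ k, quadGrad b k p * pderiv k f p

/-- The Minkowski square of the gradient. -/
noncomputable def gradSq (f : Spacetime d → ℝ) (p : Spacetime d) : ℝ :=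
  ∑ k, sig d k * pderiv k f p ^ 2

/-- The current of the multiplier `along b ψ + κ ψ` for the operator `□ + s`. -/
noncomputable def current (b : Fin (d + 1) → ℝ) (κ : ℝ) (s ψ : Spacetime d → ℝ)
    (l : Fin (d + 1)) (p : Spacetime d) : ℝ :=
  sig d l * (along b ψ p * pderiv l ψ p) - 1 / 2 * (quadGrad b l p * gradSq ψ p)
    + κ * sig d l * (ψ p * pderiv l ψ p) + 1 / 2 * (s p * quadGrad b l p * ψ p ^ 2)

theorem contDiff_quadGrad (b : Fin (d + 1) → ℝ) (l : Fin (d + 1)) {n : WithTop ℕ∞} :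
    ContDiff ℝ n (quadGrad b l) :=
  contDiff_const.mul (coord d l).contDiff

theorem contDiff_along (b : Fin (d + 1) → ℝ) {f : Spacetime d → ℝ} (hf : ContDiff ℝ 2 f) :
    ContDiff ℝ 1 (along b f) :=
  ContDiff.sum fun k _ => (contDiff_quadGrad b k).mul (contDiff_pderiv hf (by norm_num) k)

theorem contDiff_gradSq {f : Spacetime d → ℝ} (hf : ContDiff ℝ 2 f) :
    ContDiff ℝ 1 (gradSq f) :=
  ContDiff.sum fun k _ => contDiff_const.mul ((contDiff_pderiv hf (by norm_num) k).pow 2)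

theorem contDiff_current (b : Fin (d + 1) → ℝ) (κ : ℝ) {s ψ : Spacetime d → ℝ}
    (hs : ContDiff ℝ 1 s) (hψ : ContDiff ℝ 2 ψ) (l : Fin (d + 1)) :
    ContDiff ℝ 1 (current b κ s ψ l) := by
  have h1 : ContDiff ℝ 1 ψ := hψ.of_le (by norm_num)
  have h2 := contDiff_pderiv hψ (m := 1) (by norm_num) l
  exact (((contDiff_const.mul ((contDiff_along b hψ).mul h2)).sub
    (contDiff_const.mul ((contDiff_quadGrad b l).mul (contDiff_gradSq hψ)))).add
    (contDiff_const.mul (h1.mul h2))).add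
    (contDiff_const.mul ((hs.mul (contDiff_quadGrad b l)).mul (h1.pow 2)))

theorem pderiv_quadGrad (b : Fin (d + 1) → ℝ) (k l : Fin (d + 1)) (p : Spacetime d) :
    pderiv l (quadGrad b k) p = if l = k then 2 * sig d k * b k else 0 := by
  refine (pderiv_const_mul (p := p) l (2 * sig d k * b k) (coord d k).differentiableAt).trans ?_
  rw [pderiv_coord]
  simp

theorem pderiv_along (b : Fin (d + 1) → ℝ) {ψ : Spacetime d → ℝ} (hψ : ContDiff ℝ 2 ψ)
    (l : Fin (d + 1)) (p : Spacetime d) :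
    pderiv l (along b ψ) p = 2 * sig d l * b l * pderiv l ψ p
      + ∑ k, quadGrad b k p * pderiv l (pderiv k ψ) p := by
  have hg : ∀ k, DifferentiableAt ℝ (pderiv k ψ) p := fun k =>
    (contDiff_pderiv hψ (m := 1) (by norm_num) k).differentiable one_ne_zero p
  have hY : ∀ k, DifferentiableAt ℝ (quadGrad b k) p := fun k =>
    (contDiff_quadGrad b k (n := 1)).differentiable one_ne_zero p
  have := pderiv_sum (p := p) l Finset.univ
    (F := fun k x => quadGrad b k x * pderiv k ψ x) fun k _ => (hY k).mul (hg k)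
  refine this.trans ?_
  simp_rw [fun k => pderiv_mul l (hY k) (hg k), pderiv_quadGrad, Finset.sum_add_distrib]
  simp

theorem pderiv_gradSq {ψ : Spacetime d → ℝ} (hψ : ContDiff ℝ 2 ψ)
    (l : Fin (d + 1)) (p : Spacetime d) :
    pderiv l (gradSq ψ) p =
      ∑ k, sig d k * (2 * pderiv k ψ p * pderiv l (pderiv k ψ) p) := by
  have hg : ∀ k, DifferentiableAt ℝ (pderiv k ψ) p := fun k =>
    (contDiff_pderiv hψ (m := 1) (by norm_num) k).differentiable one_ne_zero p
  have := pderiv_sum (p := p) l Finset.univ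
    (F := fun k x => sig d k * pderiv k ψ x ^ 2) fun k _ => ((hg k).pow 2).const_mul _
  refine this.trans (Finset.sum_congr rfl fun k _ => ?_)
  rw [pderiv_const_mul l _ ((hg k).fun_pow 2), pderiv_sq l (hg k)]

theorem pderiv_current (b : Fin (d + 1) → ℝ) (κ : ℝ) {s ψ : Spacetime d → ℝ}
    (hs : ContDiff ℝ 1 s) (hψ : ContDiff ℝ 2 ψ) (l : Fin (d + 1)) (p : Spacetime d) :
    pderiv l (current b κ s ψ l) p =
      2 * b l * pderiv l ψ p ^ 2
      + sig d l * (∑ k, quadGrad b k p * pderiv l (pderiv k ψ) p) * pderiv l ψ p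
      + along b ψ p * (sig d l * pderiv l (pderiv l ψ) p)
      - sig d l * b l * gradSq ψ p
      - quadGrad b l p * (∑ k, sig d k * (pderiv k ψ p * pderiv l (pderiv k ψ) p))
      + κ * (sig d l * pderiv l ψ p ^ 2) + κ * ψ p * (sig d l * pderiv l (pderiv l ψ) p)
      + 1 / 2 * (quadGrad b l p * pderiv l s p) * ψ p ^ 2
      + sig d l * b l * s p * ψ p ^ 2
      + s p * ψ p * (quadGrad b l p * pderiv l ψ p) := by
  have hs1 : DifferentiableAt ℝ s p := hs.differentiable one_ne_zero p
  have h1 : DifferentiableAt ℝ ψ p := hψ.differentiable two_ne_zero p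
  have h2 : DifferentiableAt ℝ (pderiv l ψ) p :=
    (contDiff_pderiv hψ (m := 1) (by norm_num) l).differentiable one_ne_zero p
  have hY : DifferentiableAt ℝ (quadGrad b l) p :=
    (contDiff_quadGrad b l (n := 1)).differentiable one_ne_zero p
  have hN : DifferentiableAt ℝ (along b ψ) p :=
    (contDiff_along b hψ).differentiable one_ne_zero p
  have hG : DifferentiableAt ℝ (gradSq ψ) p :=
    (contDiff_gradSq hψ).differentiable one_ne_zero p
  have e : pderiv l (gradSq ψ) p =
      2 * ∑ k, sig d k * (pderiv k ψ p * pderiv l (pderiv k ψ) p) := by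
    rw [pderiv_gradSq hψ, Finset.mul_sum]
    exact Finset.sum_congr rfl fun k _ => by ring
  have hsq := sig_mul_self l
  unfold current
  rw [pderiv_add l (by fun_prop) (by fun_prop), pderiv_add l (by fun_prop) (by fun_prop),
    pderiv_sub l (by fun_prop) (by fun_prop), pderiv_const_mul l _ (by fun_prop),
    pderiv_const_mul l _ (by fun_prop), pderiv_const_mul l _ (by fun_prop),
    pderiv_const_mul l _ (by fun_prop), pderiv_mul l hN h2, pderiv_mul l hY hG, pderiv_mul l h1 h2,
    pderiv_mul l (by fun_prop) (by fun_prop), pderiv_mul l hs1 hY, pderiv_sq l h1,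
    pderiv_along b hψ, e, pderiv_quadGrad, if_pos rfl]
  linear_combination (2 * b l * pderiv l ψ p ^ 2) * hsq

/-- The multiplier identity. -/
theorem sum_pderiv_current (b : Fin (d + 1) → ℝ) (κ : ℝ) {s ψ : Spacetime d → ℝ}
    (hs : ContDiff ℝ 1 s) (hψ : ContDiff ℝ 2 ψ) (p : Spacetime d) :
    ∑ l, pderiv l (current b κ s ψ l) p =
      (along b ψ p + κ * ψ p) * (box ψ p + s p * ψ p)
      - ∑ l, ((∑ k, sig d k * b k - κ) * sig d l - 2 * b l) * pderiv l ψ p ^ 2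
      + (1 / 2 * along b s p + (∑ k, sig d k * b k - κ) * s p) * ψ p ^ 2 := by
  -- The second derivatives of ψ produced by `along b ψ` cancel those produced by half of `gradSq
  -- ψ`, by symmetry of the Hessian; only □ψ survives.
  have hcross : ∑ l, sig d l * (∑ k, quadGrad b k p * pderiv l (pderiv k ψ) p) * pderiv l ψ p
      = ∑ l, quadGrad b l p * (∑ k, sig d k * (pderiv k ψ p * pderiv l (pderiv k ψ) p)) := by
    simp_rw [Finset.mul_sum, Finset.sum_mul]
    rw [Finset.sum_comm]
    refine Finset.sum_congr rfl fun k _ => Finset.sum_congr rfl fun l _ => ?_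
    rw [pderiv_comm hψ l k]; ring
  have hq : ∑ l, ((∑ k, sig d k * b k - κ) * sig d l - 2 * b l) * pderiv l ψ p ^ 2
      = (∑ k, sig d k * b k - κ) * gradSq ψ p - ∑ l, 2 * b l * pderiv l ψ p ^ 2 := by
    rw [gradSq, Finset.mul_sum, ← Finset.sum_sub_distrib]
    exact Finset.sum_congr rfl fun l _ => by ring
  simp_rw [pderiv_current b κ hs hψ, Finset.sum_add_distrib, Finset.sum_sub_distrib,
    Finset.sum_add_distrib]
  rw [hcross, hq, box_eq_sum]
  simp only [← Finset.mul_sum, ← Finset.sum_mul, RCLike.ofReal_real_eq_id, id_eq]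
  rw [show ∑ l, sig d l * pderiv l ψ p ^ 2 = gradSq ψ p from rfl,
    show ∑ l, quadGrad b l p * pderiv l s p = along b s p from rfl,
    show ∑ l, quadGrad b l p * pderiv l ψ p = along b ψ p from rfl]
  ring

/-! ### The Carleman weight and conjugation by it. -/

/-- The diagonal quadratic form `∑ b_l (x^l)²`. -/
noncomputable def quad (b : Fin (d + 1) → ℝ) (p : Spacetime d) : ℝ :=
  ∑ k, b k * coord d k p ^ 2

/-- The Minkowski square of the gradient of `quad b`. -/
noncomputable def quadSq (b : Fin (d + 1) → ℝ) (p : Spacetime d) : ℝ :=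
  ∑ k, 4 * sig d k * b k ^ 2 * coord d k p ^ 2

theorem contDiff_quad (b : Fin (d + 1) → ℝ) {n : WithTop ℕ∞} : ContDiff ℝ n (quad b) :=
  ContDiff.sum fun k _ => contDiff_const.mul ((coord d k).contDiff.pow 2)

theorem contDiff_quadSq (b : Fin (d + 1) → ℝ) {n : WithTop ℕ∞} : ContDiff ℝ n (quadSq b) :=
  ContDiff.sum fun k _ => contDiff_const.mul ((coord d k).contDiff.pow 2)

theorem pderiv_sum_mul_coord_sq (c : Fin (d + 1) → ℝ) (l : Fin (d + 1)) (p : Spacetime d) :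
    pderiv l (fun p => ∑ k, c k * coord d k p ^ 2) p = 2 * c l * coord d l p := by
  have hc : ∀ k, DifferentiableAt ℝ (fun x => coord d k x) p := fun k => (coord d k).differentiableAt
  rw [pderiv_sum l _ fun k _ => ((hc k).fun_pow 2).const_mul _]
  simp_rw [fun k => pderiv_const_mul l (c k) ((hc k).fun_pow 2), fun k => pderiv_sq l (hc k),
    pderiv_coord]
  simp; ring

theorem pderiv_quad (b : Fin (d + 1) → ℝ) (l : Fin (d + 1)) (p : Spacetime d) :
    pderiv l (quad b) p = 2 * b l * coord d l p :=
  pderiv_sum_mul_coord_sq b l p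

theorem pderiv_quadSq (b : Fin (d + 1) → ℝ) (l : Fin (d + 1)) (p : Spacetime d) :
    pderiv l (quadSq b) p = 8 * sig d l * b l ^ 2 * coord d l p := by
  refine (pderiv_sum_mul_coord_sq (fun k => 4 * sig d k * b k ^ 2) l p).trans ?_
  ring

theorem along_quad (b : Fin (d + 1) → ℝ) (p : Spacetime d) : along b (quad b) p = quadSq b p :=
  Finset.sum_congr rfl fun k _ => by rw [pderiv_quad, quadGrad]; ring

theorem along_quadSq (b : Fin (d + 1) → ℝ) (p : Spacetime d) :
    along b (quadSq b) p = 16 * ∑ k, b k ^ 3 * coord d k p ^ 2 := by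
  rw [Finset.mul_sum]
  refine Finset.sum_congr rfl fun k _ => ?_
  rw [pderiv_quadSq, quadGrad]
  linear_combination (16 * b k ^ 3 * coord d k p ^ 2) * sig_mul_self k

/-- The exponent of the Carleman weight, a convexification of `quad b`. -/
noncomputable def phase (b : Fin (d + 1) → ℝ) (p : Spacetime d) : ℝ :=
  -(1 / 3) * Real.exp (-3 * quad b p)

theorem contDiff_phase (b : Fin (d + 1) → ℝ) {n : WithTop ℕ∞} : ContDiff ℝ n (phase b) :=
  contDiff_const.mul (Real.contDiff_exp.comp (contDiff_const.mul (contDiff_quad b)))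

theorem pderiv_exp_quad (b : Fin (d + 1) → ℝ) (c : ℝ) (l : Fin (d + 1)) (p : Spacetime d) :
    pderiv l (fun x => Real.exp (c * quad b x)) p
      = c * Real.exp (c * quad b p) * (2 * b l * coord d l p) := by
  have hq : DifferentiableAt ℝ (quad b) p := (contDiff_quad b (n := 1)).differentiable one_ne_zero p
  rw [pderiv_comp l (Real.hasDerivAt_exp _) (hq.const_mul c), pderiv_const_mul l _ hq, pderiv_quad]
  ring

theorem pderiv_phase (b : Fin (d + 1) → ℝ) (l : Fin (d + 1)) (p : Spacetime d) :
    pderiv l (phase b) p = Real.exp (-3 * quad b p) * (2 * b l * coord d l p) := by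
  have hq : DifferentiableAt ℝ (fun x => Real.exp (-3 * quad b x)) p :=
    (Real.contDiff_exp.comp (contDiff_const.mul (contDiff_quad b (n := 1)))).differentiable
      one_ne_zero p
  refine (pderiv_const_mul l _ hq).trans ?_
  rw [pderiv_exp_quad]; ring

theorem gradSq_phase (b : Fin (d + 1) → ℝ) (p : Spacetime d) :
    gradSq (phase b) p = Real.exp (-3 * quad b p) ^ 2 * quadSq b p := by
  rw [gradSq, quadSq, Finset.mul_sum]
  refine Finset.sum_congr rfl fun l _ => ?_
  rw [pderiv_phase]; ring

/-- Conjugation by the Carleman weight. -/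
noncomputable def conj (b : Fin (d + 1) → ℝ) (lam : ℝ) (u : Spacetime d → ℝ) (p : Spacetime d) :
    ℝ :=
  Real.exp (-(lam * phase b p)) * u p

section conj

variable (b : Fin (d + 1) → ℝ) (lam : ℝ)

theorem contDiff_weight {n : WithTop ℕ∞} :
    ContDiff ℝ n fun p : Spacetime d => Real.exp (-(lam * phase b p)) :=
  Real.contDiff_exp.comp (contDiff_const.mul (contDiff_phase b)).neg

theorem contDiff_conj {u : Spacetime d → ℝ} {n : WithTop ℕ∞} (hu : ContDiff ℝ n u) :
    ContDiff ℝ n (conj b lam u) :=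
  (contDiff_weight b lam).mul hu

theorem pderiv_weight (l : Fin (d + 1)) (p : Spacetime d) :
    pderiv l (fun p => Real.exp (-(lam * phase b p))) p
      = -(lam * pderiv l (phase b) p) * Real.exp (-(lam * phase b p)) := by
  have hf : DifferentiableAt ℝ (phase b) p :=
    (contDiff_phase b (n := 1)).differentiable one_ne_zero p
  have := pderiv_comp (p := p) (F := Real.exp) (f := fun x => (-lam) * phase b x) l
    (Real.hasDerivAt_exp _) (hf.const_mul _)
  rw [pderiv_const_mul l _ hf] at this
  simp only [neg_mul] at this
  rw [this]; ring

theorem pderiv_conj {u : Spacetime d → ℝ} {p : Spacetime d} (hu : DifferentiableAt ℝ u p)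
    (l : Fin (d + 1)) :
    pderiv l (conj b lam u) p
      = Real.exp (-(lam * phase b p)) * (pderiv l u p - lam * pderiv l (phase b) p * u p) := by
  refine (pderiv_mul l ((contDiff_weight b lam (n := 1)).differentiable one_ne_zero p) hu).trans ?_
  rw [pderiv_weight]; ring

/-- Product rule for u = exp(λΦ)ψ. Since ∇Φ = e^{-3f}∇f, the first-order part is a multiple of the
same field `along b` that serves as multiplier, and the λ² term is `potential`. -/
theorem weight_mul_box {u : Spacetime d → ℝ} (hu : ContDiff ℝ 2 u) (p : Spacetime d) :
    Real.exp (-(lam * phase b p)) * box u p = box (conj b lam u) p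
      + lam ^ 2 * Real.exp (-3 * quad b p) ^ 2 * quadSq b p * conj b lam u p
      + 2 * lam * Real.exp (-3 * quad b p) * along b (conj b lam u) p
      + lam * box (phase b) p * conj b lam u p := by
  have hud : ∀ x, DifferentiableAt ℝ u x := hu.differentiable two_ne_zero
  have hf : ∀ l, DifferentiableAt ℝ (pderiv l (phase b)) p := fun l =>
    (contDiff_pderiv (contDiff_phase b (n := 2)) (m := 1) (by norm_num) l).differentiable
      one_ne_zero p
  have hul : ∀ l, DifferentiableAt ℝ (pderiv l u) p := fun l =>
    (contDiff_pderiv hu (m := 1) (by norm_num) l).differentiable one_ne_zero p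
  have hE := (contDiff_weight b lam (n := 1)).differentiable one_ne_zero p
  have h2 : ∀ l, pderiv l (pderiv l (conj b lam u)) p = Real.exp (-(lam * phase b p)) *
      (pderiv l (pderiv l u) p - 2 * lam * pderiv l (phase b) p * pderiv l u p
        - lam * pderiv l (pderiv l (phase b)) p * u p
        + lam ^ 2 * pderiv l (phase b) p ^ 2 * u p) := by
    intro l
    have hfl := hf l
    have hull := hul l
    have hup := hud p
    rw [show pderiv l (conj b lam u) = fun x => Real.exp (-(lam * phase b x)) *
      (pderiv l u x - (lam * pderiv l (phase b) x) * u x) from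
      funext fun x => pderiv_conj b lam (hud x) l,
      pderiv_mul l hE (by fun_prop), pderiv_weight, pderiv_sub l hull (by fun_prop),
      pderiv_mul l (by fun_prop) hup, pderiv_const_mul l _ hfl]
    ring
  have hal : along b (conj b lam u) p * Real.exp (-3 * quad b p)
      = ∑ l, sig d l * pderiv l (phase b) p * pderiv l (conj b lam u) p := by
    rw [along, Finset.sum_mul]
    refine Finset.sum_congr rfl fun l _ => ?_
    rw [pderiv_phase, quadGrad]; ring
  have h3 : lam ^ 2 * Real.exp (-3 * quad b p) ^ 2 * quadSq b p = lam ^ 2 * gradSq (phase b) p := by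
    rw [gradSq_phase]; ring
  have h4 : 2 * lam * Real.exp (-3 * quad b p) * along b (conj b lam u) p
      = 2 * lam * ∑ l, sig d l * pderiv l (phase b) p * pderiv l (conj b lam u) p := by
    rw [← hal]; ring
  rw [h3, h4, box_eq_sum, box_eq_sum, box_eq_sum, gradSq]
  simp only [Finset.mul_sum, Finset.sum_mul, ← Finset.sum_add_distrib]
  refine Finset.sum_congr rfl fun l _ => ?_
  rw [h2, pderiv_conj b lam (hud p), conj]
  simp only [RCLike.ofReal_real_eq_id, id_eq]
  ring

/-- The potential that the conjugation produces. -/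
noncomputable def potential (p : Spacetime d) : ℝ :=
  lam ^ 2 * (Real.exp (-6 * quad b p) * quadSq b p)

theorem contDiff_potential {n : WithTop ℕ∞} :
    ContDiff ℝ n (potential b lam : Spacetime d → ℝ) :=
  contDiff_const.mul
    ((Real.contDiff_exp.comp (contDiff_const.mul (contDiff_quad b))).mul (contDiff_quadSq b))

theorem exp_quad_sq (p : Spacetime d) :
    Real.exp (-6 * quad b p) = Real.exp (-3 * quad b p) ^ 2 := by
  rw [← Real.exp_nat_mul]; congr 1; push_cast; ring

/-- The derivative of f along ∇f is `quadSq`, so the exponential contributes the term -6 `quadSq`².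
This gain from convexification dominates once `quadSq` is bounded below. -/
theorem along_potential (p : Spacetime d) :
    along b (potential b lam) p = lam ^ 2 * Real.exp (-6 * quad b p) *
      (16 * ∑ k, b k ^ 3 * coord d k p ^ 2 - 6 * quadSq b p ^ 2) := by
  have hq : DifferentiableAt ℝ (fun x => Real.exp (-6 * quad b x)) p :=
    (Real.contDiff_exp.comp (contDiff_const.mul (contDiff_quad b (n := 1)))).differentiable
      one_ne_zero p
  have hQ : DifferentiableAt ℝ (quadSq b) p :=
    (contDiff_quadSq b (n := 1)).differentiable one_ne_zero p
  have h : ∀ l, quadGrad b l p * pderiv l (potential b lam) p = lam ^ 2 * Real.exp (-6 * quad b p) *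
      (quadGrad b l p * pderiv l (quadSq b) p
        - 6 * quadSq b p * (quadGrad b l p * pderiv l (quad b) p)) := by
    intro l
    have : pderiv l (potential b lam) p = _ :=
      (pderiv_const_mul l (lam ^ 2) (hq.mul hQ)).trans (congrArg _ (pderiv_mul l hq hQ))
    rw [this, pderiv_exp_quad, pderiv_quad]; ring
  rw [along, Finset.sum_congr rfl fun l _ => h l, ← Finset.mul_sum, Finset.sum_sub_distrib,
    ← Finset.mul_sum, ← along_quadSq]
  rw [show ∑ l, quadGrad b l p * pderiv l (quad b) p = quadSq b p from along_quad b p, along]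
  ring

end conj

/-! ### Pseudoconvexity and the pointwise Carleman estimate. -/

/-- The coefficients of `|x|² - a t²`. -/
noncomputable def coef (d : ℕ) (a : ℝ) : Fin (d + 1) → ℝ := Fin.cons (-a) (fun _ => 1)

theorem sum_coef (a : ℝ) : ∑ k, sig d k * coef d a k = a + d := by
  simp [Fin.sum_univ_succ, sig, coef]

theorem norm_sq_eq_sum (x : EuclideanSpace ℝ (Fin d)) : ‖x‖ ^ 2 = ∑ i, x i ^ 2 := by
  rw [EuclideanSpace.norm_sq_eq]; simp

theorem quad_coef (a : ℝ) (p : Spacetime d) : quad (coef d a) p = ‖p.2‖ ^ 2 - a * p.1 ^ 2 := by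
  simp [quad, Fin.sum_univ_succ, coef, norm_sq_eq_sum]; ring

theorem quadSq_coef (a : ℝ) (p : Spacetime d) :
    quadSq (coef d a) p = 4 * (‖p.2‖ ^ 2 - a ^ 2 * p.1 ^ 2) := by
  simp [quadSq, Fin.sum_univ_succ, coef, sig, norm_sq_eq_sum, ← Finset.mul_sum]; ring

theorem sum_coef_cube (a : ℝ) (p : Spacetime d) :
    ∑ k, coef d a k ^ 3 * coord d k p ^ 2 = ‖p.2‖ ^ 2 - a ^ 3 * p.1 ^ 2 := by
  simp [Fin.sum_univ_succ, coef, norm_sq_eq_sum]; ring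

/-- Pseudoconvexity of the levels of `|x|² - a t²`, in the form the Carleman estimate needs. -/
theorem sum_pderiv_current_le {a : ℝ} (ha : 1 ≤ a) (ha' : a ≤ 3 / 2) (lam : ℝ)
    {ψ : Spacetime d → ℝ} (hψ : ContDiff ℝ 2 ψ) {p : Spacetime d}
    (hp : 2 ≤ quadSq (coef d a) p) :
    ∑ l, pderiv l (current (coef d a) (d - 1) (potential (coef d a) lam) ψ l) p ≤
      (along (coef d a) ψ p + (d - 1) * ψ p) * (box ψ p + potential (coef d a) lam p * ψ p)
      - (a - 1) * ∑ l, pderiv l ψ p ^ 2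
      - 3 * lam ^ 2 * Real.exp (-3 * quad (coef d a) p) ^ 2 * ψ p ^ 2 := by
  rw [sum_pderiv_current _ _ (contDiff_potential _ _) hψ, sum_coef, along_potential, sum_coef_cube,
    potential, exp_quad_sq]
  -- The choice κ = d - 1 makes the quadratic form isotropic: the time entry -(a + 1) + 2a and the
  -- space entries (a + 1) - 2 all equal a - 1.
  have h1 : ∑ l, ((a + d - (d - 1)) * sig d l - 2 * coef d a l) * pderiv l ψ p ^ 2
      = (a - 1) * ∑ l, pderiv l ψ p ^ 2 := by
    rw [Finset.mul_sum]
    refine Finset.sum_congr rfl fun l _ => ?_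
    refine Fin.cases ?_ (fun i => ?_) l <;>
      simp only [sig, coef, Fin.cons_zero, Fin.cons_succ] <;> ring
  rw [h1]
  set q := quadSq (coef d a) p with hq
  have h2 : 16 * (‖p.2‖ ^ 2 - a ^ 3 * p.1 ^ 2) ≤ 4 * q := by
    rw [hq, quadSq_coef]
    nlinarith [mul_nonneg (mul_nonneg (sq_nonneg a) (sub_nonneg.2 ha)) (sq_nonneg p.1)]
  -- As a + 1 ≤ 5/2, the left side is at most (9/2)q - 3q², which decreases for q ≥ 2 and equals -3
  -- at q = 2. This is where the rate 3 in `phase` is used.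
  have h3 : 1 / 2 * (16 * (‖p.2‖ ^ 2 - a ^ 3 * p.1 ^ 2) - 6 * q ^ 2) + (a + 1) * q ≤ -3 := by
    nlinarith
  have h4 := mul_le_mul_of_nonneg_left h3
    (show 0 ≤ lam ^ 2 * Real.exp (-3 * quad (coef d a) p) ^ 2 * ψ p ^ 2 by positivity)
  linarith

/-- The part of `□` that is antisymmetric after conjugation absorbs the multiplier. -/
theorem multiplier_mul_le (b : Fin (d + 1) → ℝ) (κ : ℝ) (lam : ℝ)
    {u : Spacetime d → ℝ} (hu : ContDiff ℝ 2 u) (p : Spacetime d) :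
    8 * lam * Real.exp (-3 * quad b p) * ((along b (conj b lam u) p + κ * conj b lam u p) *
      (box (conj b lam u) p + potential b lam p * conj b lam u p)) ≤
    2 * (Real.exp (-(lam * phase b p)) * box u p) ^ 2 + 2 * lam ^ 2 *
      (box (phase b) p - 2 * κ * Real.exp (-3 * quad b p)) ^ 2 * conj b lam u p ^ 2 := by
  have h := weight_mul_box b lam hu p
  rw [potential, exp_quad_sq]
  set E := Real.exp (-3 * quad b p)
  set ψ := conj b lam u p
  set M := along b (conj b lam u) p
  set X := Real.exp (-(lam * phase b p)) * box u p
  set P := box (conj b lam u) p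
  set Q := quadSq b p
  set S := box (phase b) p
  -- The κ term is shifted to the left so that the two summands on the right are exactly the factors
  -- of the multiplier product; 4xy ≤ (x + y)² then bounds that product.
  have h5 : X - lam * (S - 2 * κ * E) * ψ
      = (P + lam ^ 2 * (E ^ 2 * Q) * ψ) + 2 * lam * E * (M + κ * ψ) := by
    rw [h]; ring
  have h6 : (X - lam * (S - 2 * κ * E) * ψ) ^ 2
      ≤ 2 * X ^ 2 + 2 * lam ^ 2 * (S - 2 * κ * E) ^ 2 * ψ ^ 2 := by
    nlinarith [sq_nonneg (X + lam * (S - 2 * κ * E) * ψ)]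
  rw [h5] at h6
  nlinarith [sq_nonneg ((P + lam ^ 2 * (E ^ 2 * Q) * ψ) - 2 * lam * E * (M + κ * ψ))]

theorem continuous_pderiv {f : Spacetime d → ℝ} (hf : ContDiff ℝ 2 f) (l : Fin (d + 1)) :
    Continuous (pderiv l f) :=
  (contDiff_pderiv hf (m := 1) (by norm_num) l).continuous

theorem continuous_box {f : Spacetime d → ℝ} (hf : ContDiff ℝ 2 f) : Continuous (box f) := by
  have h : ∀ l, Continuous (pderiv l (pderiv l f)) := fun l =>
    (contDiff_pderiv (contDiff_pderiv hf (m := 1) (by norm_num) l) (m := 0)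
      (by norm_num) l).continuous
  exact (h 0).neg.add (continuous_finsetSum _ fun i _ => h _)

/-- Transfers the differential inequality to ψ = wu, where w∂u = ∂ψ + λ(∂Φ)ψ. The price is a term of
size λ²ψ². -/
theorem sum_weight_mul_box_sq_le (b : Fin (d + 1) → ℝ) (lam : ℝ) {ι : Type*} [Fintype ι]
    {u : ι → Spacetime d → ℝ} (hu : ∀ j, ContDiff ℝ 2 (u j)) {C₀ C₁ : ℝ} (hC₀ : 0 ≤ C₀)
    {p : Spacetime d}
    (hp : ∑ j, box (u j) p ^ 2 ≤ C₀ * ∑ j, (u j p ^ 2 + ∑ l, pderiv l (u j) p ^ 2))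
    (hA : ∀ l, pderiv l (phase b) p ^ 2 ≤ C₁) :
    ∑ j, (Real.exp (-(lam * phase b p)) * box (u j) p) ^ 2 ≤
      C₀ * (∑ j, conj b lam (u j) p ^ 2 + 2 * ∑ j, ∑ l, pderiv l (conj b lam (u j)) p ^ 2
        + 2 * (d + 1) * lam ^ 2 * C₁ * ∑ j, conj b lam (u j) p ^ 2) := by
  set w := Real.exp (-(lam * phase b p)) with hw
  have h1 : ∑ j, (w * box (u j) p) ^ 2 = w ^ 2 * ∑ j, box (u j) p ^ 2 := by
    rw [Finset.mul_sum]; exact Finset.sum_congr rfl fun _ _ => by ring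
  have h3 : ∀ j l, w ^ 2 * pderiv l (u j) p ^ 2 ≤
      2 * pderiv l (conj b lam (u j)) p ^ 2 + 2 * lam ^ 2 * C₁ * conj b lam (u j) p ^ 2 := by
    intro j l
    have h4 : w * pderiv l (u j) p
        = pderiv l (conj b lam (u j)) p + lam * pderiv l (phase b) p * conj b lam (u j) p := by
      rw [pderiv_conj b lam ((hu j).differentiable two_ne_zero p), conj, ← hw]
      ring
    have h5 := mul_le_mul_of_nonneg_left (hA l)
      (show 0 ≤ lam ^ 2 * conj b lam (u j) p ^ 2 by positivity)
    rw [← mul_pow, h4]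
    refine add_sq_le.trans ?_
    rw [mul_pow, mul_pow]
    linarith
  have h2 : ∀ j, w ^ 2 * (u j p ^ 2 + ∑ l, pderiv l (u j) p ^ 2) ≤
      conj b lam (u j) p ^ 2 + 2 * ∑ l, pderiv l (conj b lam (u j)) p ^ 2
        + 2 * (d + 1) * lam ^ 2 * C₁ * conj b lam (u j) p ^ 2 := by
    intro j
    have h6 := Finset.sum_le_sum fun l (_ : l ∈ Finset.univ) => h3 j l
    rw [← Finset.mul_sum, Finset.sum_add_distrib, ← Finset.mul_sum, Finset.sum_const,
      Finset.card_univ, Fintype.card_fin, nsmul_eq_mul] at h6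
    push_cast at h6
    have h7 : w ^ 2 * u j p ^ 2 = conj b lam (u j) p ^ 2 := by rw [conj, mul_pow]
    rw [mul_add, h7]; linarith
  have h8 := Finset.sum_le_sum fun j (_ : j ∈ Finset.univ) => h2 j
  rw [← Finset.mul_sum] at h8
  rw [h1, Finset.mul_sum _ _ (2 : ℝ), Finset.mul_sum _ _ (2 * (d + 1) * lam ^ 2 * C₁),
    ← Finset.sum_add_distrib, ← Finset.sum_add_distrib]
  calc w ^ 2 * ∑ j, box (u j) p ^ 2
      ≤ w ^ 2 * (C₀ * ∑ j, (u j p ^ 2 + ∑ l, pderiv l (u j) p ^ 2)) :=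
        mul_le_mul_of_nonneg_left hp (sq_nonneg _)
    _ = C₀ * (w ^ 2 * ∑ j, (u j p ^ 2 + ∑ l, pderiv l (u j) p ^ 2)) := by ring
    _ ≤ _ := mul_le_mul_of_nonneg_left h8 hC₀

/-- The bound on `Z` carries a factor 1/(8λE), so for large λ it falls below ε(N₁ + λ²N₀). That is
absorbed by δN₁ and one of the three copies of λ²E²N₀; another copy gives the final -c₀²N₀. -/
theorem absorb_lower_order {C₀ C₁ ε c₀ E lam N₀ N₁ Z X n δ : ℝ} (hC₀ : 0 ≤ C₀) (hC₁ : 0 ≤ C₁) (hN₀' : 0 ≤ N₀)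
    (hN₁' : 0 ≤ N₁) (hε₁ : ε ≤ δ) (hε₂ : ε ≤ c₀ ^ 2) (hε : 0 ≤ ε) (hc₀pos : 0 < c₀)
    (hEp : c₀ ≤ E) (hlam : 1 ≤ lam) (hn : 0 ≤ n)
    (hlam2 : 6 * C₀ + 4 * C₀ * n * C₁ + 2 * C₁ ≤ 8 * c₀ * ε * lam)
    (hX : X ≤ C₀ * (N₀ + 2 * N₁ + 2 * n * lam ^ 2 * C₁ * N₀))
    (hZ : 8 * lam * E * Z ≤ 2 * X + 2 * lam ^ 2 * C₁ * N₀) :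
    Z - δ * N₁ - 3 * lam ^ 2 * E ^ 2 * N₀ ≤ -c₀ ^ 2 * N₀ := by
  have hlam0 : 0 < lam := by linarith
  have hEpos : 0 < E := by linarith
  have hlamsq : 1 ≤ lam ^ 2 := one_le_pow₀ hlam
  have hZ2 : 8 * lam * E * Z ≤ (6 * C₀ + 4 * C₀ * n * C₁ + 2 * C₁) * (N₁ + lam ^ 2 * N₀) := by
    have e1 : N₀ ≤ lam ^ 2 * N₀ := le_mul_of_one_le_left hN₀' hlamsq
    have e2 := mul_le_mul_of_nonneg_left e1 hC₀
    have e3 : 0 ≤ C₀ * N₁ := by positivity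
    have e4 : 0 ≤ C₁ * N₁ := by positivity
    have e5 : 0 ≤ C₀ * n * C₁ * N₁ := by positivity
    have e6 : 0 ≤ C₀ * (lam ^ 2 * N₀) := by positivity
    linarith
  have hZ3 : 8 * lam * E * Z ≤ 8 * lam * E * (ε * (N₁ + lam ^ 2 * N₀)) := by
    refine hZ2.trans ?_
    have h1 : 6 * C₀ + 4 * C₀ * n * C₁ + 2 * C₁ ≤ 8 * lam * E * ε := by
      refine hlam2.trans ?_
      have : 8 * ε * lam * c₀ ≤ 8 * ε * lam * E := mul_le_mul_of_nonneg_left hEp (by positivity)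
      linarith
    have := mul_le_mul_of_nonneg_right h1 (show 0 ≤ N₁ + lam ^ 2 * N₀ by positivity)
    linarith
  have hZ4 : Z ≤ ε * (N₁ + lam ^ 2 * N₀) :=
    le_of_mul_le_mul_left hZ3 (by positivity)
  have e1 : ε * N₁ ≤ δ * N₁ := mul_le_mul_of_nonneg_right (hε₁) hN₁'
  have e2 : ε * (lam ^ 2 * N₀) ≤ c₀ ^ 2 * (lam ^ 2 * N₀) :=
    mul_le_mul_of_nonneg_right (hε₂) (by positivity)
  have e3 : c₀ ^ 2 * (lam ^ 2 * N₀) ≤ E ^ 2 * (lam ^ 2 * N₀) :=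
    mul_le_mul_of_nonneg_right (pow_le_pow_left₀ hc₀pos.le hEp 2) (by positivity)
  have e4 : c₀ ^ 2 * N₀ ≤ c₀ ^ 2 * (lam ^ 2 * N₀) :=
    mul_le_mul_of_nonneg_left (le_mul_of_one_le_left hN₀' hlamsq) (by positivity)
  have e5 : 0 ≤ E ^ 2 * (lam ^ 2 * N₀) := by positivity
  linarith

/-- The pointwise Carleman estimate, uniform on a compact set. -/
theorem carleman_pointwise {a : ℝ} (ha : 1 < a) (ha' : a ≤ 3 / 2) {ι : Type*} [Fintype ι]
    {K S : Set (Spacetime d)} (hK : IsCompact K) (hSK : S ⊆ K)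
    (hq : ∀ p ∈ K, 2 ≤ quadSq (coef d a) p) {u : ι → Spacetime d → ℝ}
    (hu : ∀ j, ContDiff ℝ 2 (u j)) {C₀ : ℝ} (hC₀ : 0 ≤ C₀)
    (hineq : ∀ p ∈ S, ∑ j, box (u j) p ^ 2 ≤
      C₀ * ∑ j, (u j p ^ 2 + ∑ l, pderiv l (u j) p ^ 2)) :
    ∃ c > 0, ∃ L : ℝ, ∀ lam ≥ L, ∀ p ∈ S,
      ∑ j, ∑ l, pderiv l (current (coef d a) (d - 1) (potential (coef d a) lam)
        (conj (coef d a) lam (u j)) l) p ≤ -c * ∑ j, conj (coef d a) lam (u j) p ^ 2 := by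
  set b := coef d a with hb
  have hquad : Continuous (quad b : Spacetime d → ℝ) := (contDiff_quad b (n := 0)).continuous
  have hph : ContDiff ℝ 2 (phase b : Spacetime d → ℝ) := contDiff_phase b
  obtain ⟨A, hA⟩ := hK.exists_bound_of_continuousOn
    (f := fun p => ∑ l, pderiv l (phase b) p ^ 2)
    (continuous_finsetSum _ fun l _ => (continuous_pderiv hph l).pow 2).continuousOn
  obtain ⟨B, hB⟩ := hK.exists_bound_of_continuousOn
    (f := fun p => (box (phase b) p - 2 * ((d : ℝ) - 1) * Real.exp (-3 * quad b p)) ^ 2)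
    (by have := continuous_box hph; fun_prop)
  obtain ⟨D, hD⟩ := hK.exists_bound_of_continuousOn
    (f := fun p => Real.exp (3 * quad b p)) (by fun_prop)
  -- A positive lower bound for e^{-3f} on `K`, obtained from an upper bound for e^{3f}.
  set c₀ := (|D| + 1)⁻¹ with hc₀
  have hc₀pos : 0 < c₀ := by positivity
  have hE : ∀ p ∈ K, c₀ ≤ Real.exp (-3 * quad b p) := by
    intro p hp
    have h1 := hD p hp
    rw [Real.norm_of_nonneg (Real.exp_pos _).le] at h1
    rw [neg_mul, Real.exp_neg, hc₀]
    exact inv_anti₀ (Real.exp_pos _) (by linarith [le_abs_self D])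
  set C₁ := |A| + |B| with hC₁
  have hC₁' : 0 ≤ C₁ := by positivity
  have hA' : ∀ p ∈ K, ∀ l, pderiv l (phase b) p ^ 2 ≤ C₁ := by
    intro p hp l
    have h1 := (le_abs_self _).trans (hA p hp)
    have h2 := Finset.single_le_sum (f := fun l => pderiv l (phase b) p ^ 2)
      (fun l _ => sq_nonneg _) (Finset.mem_univ l)
    linarith [le_abs_self A, abs_nonneg B]
  have hB' : ∀ p ∈ K, (box (phase b) p - 2 * ((d : ℝ) - 1) * Real.exp (-3 * quad b p)) ^ 2 ≤ C₁ := by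
    intro p hp
    have h1 := (le_abs_self _).trans (hB p hp)
    linarith [le_abs_self B, abs_nonneg A]
  set C₂ := 6 * C₀ + 4 * C₀ * (d + 1) * C₁ + 2 * C₁ with hC₂
  have hC₂' : 0 ≤ C₂ := by positivity
  set ε := min (a - 1) (c₀ ^ 2) with hε
  have hεpos : 0 < ε := lt_min (by linarith) (by positivity)
  refine ⟨c₀ ^ 2, by positivity, max 1 (C₂ / (8 * c₀ * ε)), fun lam hlam p hpS => ?_⟩
  have hp := hSK hpS
  have hlam1 : 1 ≤ lam := (le_max_left _ _).trans hlam
  have hlam2 : C₂ ≤ 8 * c₀ * ε * lam := by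
    have := (le_max_right _ _).trans hlam
    rw [div_le_iff₀ (by positivity)] at this
    linarith
  set E := Real.exp (-3 * quad b p)
  have hEp : c₀ ≤ E := hE p hp
  have hEpos : 0 < E := Real.exp_pos _
  set w := Real.exp (-(lam * phase b p))
  set ψ : ι → Spacetime d → ℝ := fun j => conj b lam (u j)
  set N₀ := ∑ j, ψ j p ^ 2 with hN₀
  set N₁ := ∑ j, ∑ l, pderiv l (ψ j) p ^ 2 with hN₁
  have hN₀' : 0 ≤ N₀ := Finset.sum_nonneg fun _ _ => sq_nonneg _
  have hN₁' : 0 ≤ N₁ := Finset.sum_nonneg fun _ _ => Finset.sum_nonneg fun _ _ => sq_nonneg _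
  set Z : ι → ℝ := fun j => (along b (ψ j) p + (d - 1) * ψ j p) *
    (box (ψ j) p + potential b lam p * ψ j p)
  have hdiv : ∑ j, ∑ l, pderiv l (current b (d - 1) (potential b lam) (ψ j) l) p
      ≤ ∑ j, Z j - (a - 1) * N₁ - 3 * lam ^ 2 * E ^ 2 * N₀ := by
    rw [hN₁, hN₀, Finset.mul_sum, Finset.mul_sum, ← Finset.sum_sub_distrib,
      ← Finset.sum_sub_distrib]
    exact Finset.sum_le_sum fun j _ =>
      sum_pderiv_current_le ha.le ha' lam (contDiff_conj b lam (hu j)) (hq p hp)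
  have hbox : ∑ j, (w * box (u j) p) ^ 2 ≤ C₀ * (N₀ + 2 * N₁ + 2 * (d + 1) * lam ^ 2 * C₁ * N₀) :=
    sum_weight_mul_box_sq_le b lam hu hC₀ (hineq p hpS) (hA' p hp)
  have hZ : 8 * lam * E * ∑ j, Z j ≤ 2 * ∑ j, (w * box (u j) p) ^ 2 + 2 * lam ^ 2 * C₁ * N₀ := by
    rw [hN₀, Finset.mul_sum, Finset.mul_sum, Finset.mul_sum, ← Finset.sum_add_distrib]
    refine Finset.sum_le_sum fun j _ => (multiplier_mul_le b (d - 1) lam (hu j) p).trans ?_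
    have := mul_le_mul_of_nonneg_left (hB' p hp)
      (show 0 ≤ 2 * lam ^ 2 * ψ j p ^ 2 by positivity)
    linarith
  exact hdiv.trans (absorb_lower_order hC₀ hC₁' hN₀' hN₁' (min_le_left _ _) (min_le_right _ _) hεpos.le
    hc₀pos hEp hlam1 (by positivity) hlam2 hbox hZ)

/-- Factoring λ from ∂ψ leaves an expression jointly continuous in (1/λ, p) on the compact set [0,
1] × K, so the constant does not depend on λ. -/
theorem exists_abs_current_le (b : Fin (d + 1) → ℝ) (κ : ℝ) {K : Set (Spacetime d)}
    (hK : IsCompact K) {u : Spacetime d → ℝ} (hu : ContDiff ℝ 2 u) (l : Fin (d + 1)) :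
    ∃ C : ℝ, ∀ lam ≥ 1, ∀ p ∈ K, |current b κ (potential b lam) (conj b lam u) l p|
      ≤ C * lam ^ 2 * Real.exp (-(lam * phase b p)) ^ 2 := by
  have hph : ContDiff ℝ 2 (phase b : Spacetime d → ℝ) := contDiff_phase b
  have hquad : Continuous (quad b : Spacetime d → ℝ) := (contDiff_quad b (n := 0)).continuous
  have hquadSq : Continuous (quadSq b : Spacetime d → ℝ) := (contDiff_quadSq b (n := 0)).continuous
  have hY : ∀ k, Continuous (quadGrad b k : Spacetime d → ℝ) := fun k =>
    (contDiff_quadGrad b k (n := 0)).continuous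
  have huc : Continuous u := hu.continuous
  have hud := fun k => continuous_pderiv hu k
  have hpd := fun k => continuous_pderiv hph k
  -- The first component of `z` stands for 1/λ.
  let v : Fin (d + 1) → ℝ × Spacetime d → ℝ := fun k z =>
    z.1 * pderiv k u z.2 - pderiv k (phase b) z.2 * u z.2
  have hv : ∀ k, Continuous (v k) := fun k => by
    have h1 := (hud k).comp (continuous_snd (X := ℝ))
    have h2 := (hpd k).comp (continuous_snd (X := ℝ))
    have h3 := huc.comp (continuous_snd (X := ℝ))
    exact (continuous_fst.mul h1).sub (h2.mul h3)
  let H : ℝ × Spacetime d → ℝ := fun z =>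
    sig d l * ((∑ k, quadGrad b k z.2 * v k z) * v l z)
      - 1 / 2 * (quadGrad b l z.2 * ∑ k, sig d k * v k z ^ 2)
      + κ * sig d l * (z.1 * u z.2 * v l z)
      + 1 / 2 * (Real.exp (-6 * quad b z.2) * quadSq b z.2 * quadGrad b l z.2 * u z.2 ^ 2)
  have hH : Continuous H := by
    have hvl := hv l
    have hYl := hY l
    have h1 : Continuous fun z : ℝ × Spacetime d => ∑ k, quadGrad b k z.2 * v k z :=
      continuous_finsetSum _ fun k _ => ((hY k).comp continuous_snd).mul (hv k)
    have h2 : Continuous fun z : ℝ × Spacetime d => ∑ k, sig d k * v k z ^ 2 :=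
      continuous_finsetSum _ fun k _ => continuous_const.mul ((hv k).pow 2)
    fun_prop
  obtain ⟨C, hC⟩ := ((isCompact_Icc (a := (0 : ℝ)) (b := 1)).prod hK).exists_bound_of_continuousOn
    hH.continuousOn
  refine ⟨C, fun lam hlam p hp => ?_⟩
  have hlam0 : 0 < lam := by linarith
  have h1 := hC (lam⁻¹, p) ⟨⟨by positivity, inv_le_one_of_one_le₀ hlam⟩, hp⟩
  rw [Real.norm_eq_abs] at h1
  set w := Real.exp (-(lam * phase b p)) with hw
  have hψ : ∀ k, pderiv k (conj b lam u) p = lam * w * v k (lam⁻¹, p) := by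
    intro k
    rw [pderiv_conj b lam (hu.differentiable two_ne_zero p)]
    rw [← hw]
    simp only [v]
    field_simp
  have e1 : along b (conj b lam u) p = lam * w * ∑ k, quadGrad b k p * v k (lam⁻¹, p) := by
    rw [along, Finset.mul_sum]
    exact Finset.sum_congr rfl fun k _ => by rw [hψ]; ring
  have e2 : gradSq (conj b lam u) p = (lam * w) ^ 2 * ∑ k, sig d k * v k (lam⁻¹, p) ^ 2 := by
    rw [gradSq, Finset.mul_sum]
    exact Finset.sum_congr rfl fun k _ => by rw [hψ]; ring
  have e3 : current b κ (potential b lam) (conj b lam u) l p = H (lam⁻¹, p) * (lam ^ 2 * w ^ 2) := by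
    rw [current, e1, e2, hψ, potential, conj, ← hw]
    simp only [H]
    field_simp
  rw [e3, abs_mul, abs_of_nonneg (show 0 ≤ lam ^ 2 * w ^ 2 by positivity), mul_assoc]
  exact mul_le_mul_of_nonneg_right h1 (by positivity)

/-! ### Vanishing of the current on the horizon. -/

theorem hasFDerivAt_mul_zero {f g : Spacetime d → ℝ} {p : Spacetime d}
    (hf : DifferentiableAt ℝ f p) (hg : DifferentiableAt ℝ g p) (hf0 : f p = 0) (hg0 : g p = 0) :
    HasFDerivAt (fun x => f x * g x) (0 : Spacetime d →L[ℝ] ℝ) p := by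
  simpa [hf0, hg0] using hf.hasFDerivAt.fun_mul hg.hasFDerivAt

theorem hasFDerivAt_mul_zero_right {f g : Spacetime d → ℝ} {p : Spacetime d}
    (hf : DifferentiableAt ℝ f p) (hg : HasFDerivAt g (0 : Spacetime d →L[ℝ] ℝ) p)
    (hg0 : g p = 0) : HasFDerivAt (fun x => f x * g x) (0 : Spacetime d →L[ℝ] ℝ) p := by
  simpa [hg0] using hf.hasFDerivAt.fun_mul hg

/-- Being quadratic, the current vanishes to second order where the field vanishes to
first order. -/
theorem current_vanishes (b : Fin (d + 1) → ℝ) (κ : ℝ) {s ψ : Spacetime d → ℝ}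
    (hs : ContDiff ℝ 1 s) (hψ : ContDiff ℝ 2 ψ) (l : Fin (d + 1)) {p : Spacetime d}
    (h0 : ψ p = 0) (h1 : ∀ k, pderiv k ψ p = 0) :
    current b κ s ψ l p = 0 ∧ HasFDerivAt (current b κ s ψ l) (0 : Spacetime d →L[ℝ] ℝ) p := by
  have hg : ∀ k, DifferentiableAt ℝ (pderiv k ψ) p := fun k =>
    (contDiff_pderiv hψ (m := 1) (by norm_num) k).differentiable one_ne_zero p
  have hY : DifferentiableAt ℝ (quadGrad b l) p :=
    (contDiff_quadGrad b l (n := 1)).differentiable one_ne_zero p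
  have hψd : DifferentiableAt ℝ ψ p := hψ.differentiable two_ne_zero p
  have hsd : DifferentiableAt ℝ s p := hs.differentiable one_ne_zero p
  have hN : along b ψ p = 0 := by simp [along, h1]
  have hG : gradSq ψ p = 0 := by simp [gradSq, h1]
  refine ⟨by simp [current, hN, hG, h0], ?_⟩
  have hGd : HasFDerivAt (gradSq ψ) (0 : Spacetime d →L[ℝ] ℝ) p := by
    have := HasFDerivAt.fun_sum (u := Finset.univ) (x := p)
      (A := fun k x => sig d k * (pderiv k ψ x * pderiv k ψ x))
      (A' := fun _ => (0 : Spacetime d →L[ℝ] ℝ))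
      fun k _ => hasFDerivAt_mul_zero_right (differentiableAt_const _)
        (hasFDerivAt_mul_zero (hg k) (hg k) (h1 k) (h1 k)) (by simp [h1])
    rw [Finset.sum_const_zero] at this
    refine this.congr_of_eventuallyEq (Eventually.of_forall fun x => ?_)
    simp [gradSq, sq]
  have e1 := hasFDerivAt_mul_zero_right (differentiableAt_const (sig d l)) (hasFDerivAt_mul_zero
    ((contDiff_along b hψ).differentiable one_ne_zero p) (hg l) hN (h1 l)) (by simp [h1])
  have e2 := hasFDerivAt_mul_zero_right (differentiableAt_const (1 / 2 : ℝ))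
    (hasFDerivAt_mul_zero_right hY hGd hG) (by simp [hG])
  have e3 := hasFDerivAt_mul_zero_right (differentiableAt_const (κ * sig d l))
    (hasFDerivAt_mul_zero hψd (hg l) h0 (h1 l)) (by simp [h0])
  have e4 := hasFDerivAt_mul_zero_right (differentiableAt_const (1 / 2 : ℝ))
    (hasFDerivAt_mul_zero_right (hsd.mul hY) (hasFDerivAt_mul_zero hψd hψd h0 h0) (by simp [h0]))
    (by simp [h0])
  have := ((e1.fun_sub e2).fun_add e3).fun_add e4
  simp only [sub_zero, add_zero] at this
  refine this.congr_of_eventuallyEq (Eventually.of_forall fun x => ?_)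
  simp [current, sq]

/-! ### The slab, its truncations and the cutoff. -/

/-- The part of the exterior region between two times. -/
def slab (d : ℕ) (T : ℝ) : Set (Spacetime d) := exterior d ∩ {p | |p.1| < T}

theorem isOpen_exterior : IsOpen (exterior d) :=
  isOpen_lt (by fun_prop) (by fun_prop)

theorem isOpen_slab (T : ℝ) : IsOpen (slab d T) :=
  isOpen_exterior.inter (isOpen_lt (by fun_prop) (by fun_prop))

/-- A truncation of the closure of the slab. -/
def truncation (d : ℕ) (a T R : ℝ) : Set (Spacetime d) :=
  {p | |p.1| ≤ T ∧ |p.1| + 1 ≤ ‖p.2‖ ∧ quad (coef d a) p ≤ R}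

theorem isCompact_truncation {a : ℝ} (ha : 0 ≤ a) (T R : ℝ) :
    IsCompact (truncation d a T R) := by
  refine Metric.isCompact_of_isClosed_isBounded ?_ ?_
  · have h : Continuous (quad (coef d a) : Spacetime d → ℝ) :=
      (contDiff_quad _ (n := 0)).continuous
    simp only [truncation, Set.ofPred_and]
    exact (isClosed_le (by fun_prop) (by fun_prop)).inter
      ((isClosed_le (by fun_prop) (by fun_prop)).inter (isClosed_le h continuous_const))
  · refine (Metric.isBounded_closedBall (x := (0 : Spacetime d))
      (r := T + (R + a * T ^ 2 + 1))).subset ?_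
    rintro p ⟨h1, h2, h3⟩
    rw [mem_closedBall_zero_iff, Prod.norm_def, Real.norm_eq_abs]
    rw [quad_coef] at h3
    have h4 : p.1 ^ 2 ≤ T ^ 2 := sq_le_sq' (by linarith [neg_abs_le p.1]) (by linarith [le_abs_self p.1])
    have h5 := mul_le_mul_of_nonneg_left h4 ha
    have h0 := abs_nonneg p.1
    have h6 := sq_nonneg ‖p.2‖
    refine max_le (by linarith) ?_
    nlinarith [sq_nonneg (‖p.2‖ - 1)]

/-- With τ = |t| one has |x|² - a²τ² ≥ (1 + τ)² - a²τ² = (1 - (a - 1)τ)(1 + τ + aτ) ≥ 1/2, and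
`quadSq` is four times the left side. -/
theorem two_le_quadSq {a T R : ℝ} (ha : 1 ≤ a) (haT : (a - 1) * T ≤ 1 / 2) {p : Spacetime d}
    (hp : p ∈ truncation d a T R) : 2 ≤ quadSq (coef d a) p := by
  obtain ⟨h1, h2, -⟩ := hp
  rw [quadSq_coef, ← sq_abs p.1]
  have h0 := abs_nonneg p.1
  have h3 : (|p.1| + 1) ^ 2 ≤ ‖p.2‖ ^ 2 := pow_le_pow_left₀ (by positivity) h2 2
  have h4 : (a - 1) * |p.1| ≤ 1 / 2 :=
    (mul_le_mul_of_nonneg_left h1 (by linarith)).trans haT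
  have h5 : 0 ≤ (1 / 2 - (a - 1) * |p.1|) * (1 + |p.1| + a * |p.1|) :=
    mul_nonneg (by linarith) (by positivity)
  nlinarith [mul_nonneg (by linarith : (0 : ℝ) ≤ a) h0]

theorem frontier_slab {T : ℝ} {p : Spacetime d} (hp : p ∈ frontier (slab d T)) :
    p ∈ horizon d ∨ (|p.1| = T ∧ |p.1| + 1 ≤ ‖p.2‖) := by
  rw [(isOpen_slab T).frontier_eq] at hp
  have hc : IsClosed {p : Spacetime d | |p.1| + 1 ≤ ‖p.2‖ ∧ |p.1| ≤ T} := by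
    rw [Set.ofPred_and]
    exact (isClosed_le (by fun_prop) (by fun_prop)).inter (isClosed_le (by fun_prop) (by fun_prop))
  obtain ⟨h1, h2⟩ := closure_minimal
    (fun p (hp : p ∈ slab d T) => show _ ∧ _ from ⟨le_of_lt hp.1, le_of_lt hp.2⟩) hc hp.1
  rcases h1.lt_or_eq with h | h
  · rcases h2.lt_or_eq with h' | h'
    · exact absurd ⟨h, h'⟩ hp.2
    · exact Or.inr ⟨h', h1⟩
  · exact Or.inl h.symm

/-- On the lids f ≥ (T + 1)² - aT² = 1 + 2T - (a - 1)T² = 1 + 3T/2. The cutoff therefore vanishes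
there, and the lids contribute nothing to the divergence theorem. -/
theorem lt_quad_of_abs_eq {a T R : ℝ} (ha : (a - 1) * T = 1 / 2) (hT : 0 ≤ T)
    (hR : R < 1 + 3 / 2 * T) {p : Spacetime d} (h1 : |p.1| = T) (h2 : |p.1| + 1 ≤ ‖p.2‖) :
    R < quad (coef d a) p := by
  rw [quad_coef, ← sq_abs p.1, h1]
  rw [h1] at h2
  have h3 : (T + 1) ^ 2 ≤ ‖p.2‖ ^ 2 := pow_le_pow_left₀ (by positivity) h2 2
  have h4 : (a - 1) * T * T = 1 / 2 * T := by rw [ha]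
  nlinarith

/-- A cutoff along the levels of `quad b`. -/
noncomputable def cutoff (b : Fin (d + 1) → ℝ) (R : ℝ) (p : Spacetime d) : ℝ :=
  Real.smoothTransition (R + 1 - quad b p)

section cutoff

variable (b : Fin (d + 1) → ℝ) {R : ℝ} {p : Spacetime d}

theorem contDiff_cutoff (R : ℝ) : ContDiff ℝ 2 (cutoff b R) :=
  Real.smoothTransition.contDiff.comp (contDiff_const.sub (contDiff_quad b))

theorem cutoff_eq_one (h : quad b p ≤ R) : cutoff b R p = 1 :=
  Real.smoothTransition.one_of_one_le (by linarith)

theorem cutoff_eventually_zero (h : R + 1 < quad b p) : cutoff b R =ᶠ[𝓝 p] fun _ => 0 := by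
  have hq : Continuous (quad b : Spacetime d → ℝ) := (contDiff_quad b (n := 0)).continuous
  filter_upwards [hq.continuousAt.eventually_const_lt h] with x hx
  exact Real.smoothTransition.zero_of_nonpos (by linarith)

theorem pderiv_cutoff_eq_zero (h : quad b p < R ∨ R + 1 < quad b p) (l : Fin (d + 1)) :
    pderiv l (cutoff b R) p = 0 := by
  have hq : Continuous (quad b : Spacetime d → ℝ) := (contDiff_quad b (n := 0)).continuous
  have : ∃ c : ℝ, cutoff b R =ᶠ[𝓝 p] fun _ => c := by
    rcases h with h | h
    · refine ⟨1, ?_⟩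
      filter_upwards [hq.continuousAt.eventually_lt_const h] with x hx
      exact cutoff_eq_one b hx.le
    · exact ⟨0, cutoff_eventually_zero b h⟩
  obtain ⟨c, hc⟩ := this
  rw [pderiv, hc.fderiv_eq]; simp

end cutoff

/-! ### The integrated Carleman estimate and uniqueness from vanishing data. -/

instance isAddHaarMeasure_volume : (volume : Measure (Spacetime d)).IsAddHaarMeasure :=
  Measure.prod.instIsAddHaarMeasure volume volume

/-- The integrated Carleman estimate. -/
theorem exists_setIntegral_le {a T R : ℝ} (ha : 1 < a) (ha' : a ≤ 3 / 2)
    (haT : (a - 1) * T = 1 / 2) (hR : R + 2 < 1 + 3 / 2 * T)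
    {ι : Type*} [Fintype ι] {u : ι → Spacetime d → ℝ} (hu : ∀ j, ContDiff ℝ 2 (u j))
    (hu0 : ∀ p ∈ horizon d, ∀ j, u j p = 0 ∧ ∀ l, pderiv l (u j) p = 0) {C₀ : ℝ} (hC₀ : 0 ≤ C₀)
    (hineq : ∀ p ∈ exterior d, p ∈ truncation d a T (R + 2) → ∑ j, box (u j) p ^ 2 ≤
      C₀ * ∑ j, (u j p ^ 2 + ∑ l, pderiv l (u j) p ^ 2)) :
    ∃ C L : ℝ, ∀ lam ≥ L,
      ∫ p in slab d T, {p | quad (coef d a) p ≤ R}.indicator (fun p => ∑ j, u j p ^ 2) p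
        ≤ C * (lam ^ 2 * Real.exp (-(2 * (1 / 3 *
            (Real.exp (-3 * R) - Real.exp (-3 * (R + 1)))) * lam))) := by
  set b := coef d a with hb
  have hT : 0 ≤ T := by nlinarith
  set K := truncation d a T (R + 2) with hKdef
  have hK : IsCompact K := isCompact_truncation (by linarith) T (R + 2)
  set Ω := slab d T with hΩdef
  have hΩ : IsOpen Ω := isOpen_slab T
  have hquad : Continuous (quad b : Spacetime d → ℝ) := (contDiff_quad b (n := 0)).continuous
  obtain ⟨c, hc, L, hL⟩ := carleman_pointwise ha ha' hK (S := exterior d ∩ K) inter_subset_right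
    (fun p hp => two_le_quadSq ha.le haT.le hp) hu hC₀ (fun p hp => hineq p hp.1 hp.2)
  -- The transition layer is R + 1 ≤ f ≤ R + 2; its unit distance from f ≤ R produces the
  -- exponential gain.
  set X := cutoff b (R + 1) with hX
  have hXc : ContDiff ℝ 2 X := contDiff_cutoff b _
  have hbd : ∀ l, ∃ C : ℝ, 0 ≤ C ∧ ∀ lam ≥ 1, ∀ p ∈ K, |pderiv l X p * ∑ j, current b (d - 1)
      (potential b lam) (conj b lam (u j)) l p|
        ≤ C * (lam ^ 2 * Real.exp (-(lam * phase b p)) ^ 2) := by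
    intro l
    choose B hB using fun j => exists_abs_current_le b (d - 1) hK (hu j) l
    obtain ⟨A, hA⟩ := hK.exists_bound_of_continuousOn (continuous_pderiv hXc l).continuousOn
    refine ⟨|A| * |∑ j, B j|, by positivity, fun lam hlam p hp => ?_⟩
    rw [abs_mul, mul_assoc]
    refine mul_le_mul ((hA p hp).trans (le_abs_self _)) ?_ (abs_nonneg _) (abs_nonneg _)
    refine (Finset.abs_sum_le_sum_abs _ _).trans ((Finset.sum_le_sum fun j _ =>
      hB j lam hlam p hp).trans ?_)
    rw [← Finset.sum_mul, ← Finset.sum_mul, mul_assoc]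
    exact mul_le_mul_of_nonneg_right (le_abs_self _) (by positivity)
  choose B hB0 hB using hbd
  set C₁ := ∑ l, B l with hC₁
  set V := ∫ p in Ω, K.indicator (fun _ => (1 : ℝ)) p with hV
  set U : Spacetime d → ℝ := fun p => ∑ j, u j p ^ 2 with hU
  have hUc : Continuous U := continuous_finsetSum _ fun j _ => (hu j).continuous.pow 2
  have hU0 : ∀ p, 0 ≤ U p := fun p => Finset.sum_nonneg fun _ _ => sq_nonneg _
  -- The phase is `F` of f, and `F` is increasing, so the weight decreases in f.
  set F : ℝ → ℝ := fun y => -(1 / 3) * Real.exp (-3 * y) with hF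
  have hFmono : ∀ x y, x ≤ y → F x ≤ F y := by
    intro x y hxy
    have : Real.exp (-3 * y) ≤ Real.exp (-3 * x) := Real.exp_le_exp.2 (by linarith)
    simp only [hF]; linarith
  refine ⟨C₁ * V / c, max 1 L, fun lam hlam => ?_⟩
  have hlam1 : 1 ≤ lam := (le_max_left _ _).trans hlam
  have hlamL : L ≤ lam := (le_max_right _ _).trans hlam
  set Cur : Fin (d + 1) → Spacetime d → ℝ := fun l p =>
    ∑ j, current b (d - 1) (potential b lam) (conj b lam (u j)) l p with hCur
  have hcj : ∀ j l, ContDiff ℝ 1 (current b (d - 1) (potential b lam) (conj b lam (u j)) l) :=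
    fun j l => contDiff_current b _ (contDiff_potential b lam) (contDiff_conj b lam (hu j)) l
  have hCurc : ∀ l, ContDiff ℝ 1 (Cur l) := fun l => ContDiff.sum fun j _ => hcj j l
  have hWc : ∀ l, ContDiff ℝ 1 (fun p => X p * Cur l p) := fun l =>
    (hXc.of_le (by norm_num)).mul (hCurc l)
  have hX0 : ∀ p, R + 2 < quad b p → X =ᶠ[𝓝 p] fun _ => 0 := fun p hp =>
    cutoff_eventually_zero b (by linarith)
  have hdiv : ∀ l, IntegrableOn (fun p => pderiv l (fun p => X p * Cur l p) p) Ω ∧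
      ∫ p in Ω, pderiv l (fun p => X p * Cur l p) p = 0 := by
    intro l
    refine setIntegral_fderiv_eq_zero hΩ hK (hWc l) ?_ ?_ _
    · intro p hp
      rcases frontier_slab hp with h | ⟨h1, h2⟩
      · have h3 : ∀ j, conj b lam (u j) p = 0 := fun j => by simp [conj, (hu0 p h j).1]
        have h4 : ∀ j k, pderiv k (conj b lam (u j)) p = 0 := fun j k => by
          rw [pderiv_conj b lam ((hu j).differentiable two_ne_zero p), (hu0 p h j).1,
            (hu0 p h j).2]
          simp
        have h5 := fun j => current_vanishes b (d - 1) (contDiff_potential b lam)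
          (contDiff_conj b lam (hu j)) l (h3 j) (h4 j)
        have h6 : Cur l p = 0 := Finset.sum_eq_zero fun j _ => (h5 j).1
        have h7 : HasFDerivAt (Cur l) (0 : Spacetime d →L[ℝ] ℝ) p := by
          have := HasFDerivAt.fun_sum (u := Finset.univ) fun j _ => (h5 j).2
          simpa using this
        exact ⟨by simp [h6], (hasFDerivAt_mul_zero_right
          (hXc.differentiable two_ne_zero p) h7 h6).fderiv⟩
      · have h3 : (fun p => X p * Cur l p) =ᶠ[𝓝 p] fun _ => 0 := by
          filter_upwards [hX0 p (lt_quad_of_abs_eq haT hT hR h1 h2)] with x hx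
          rw [hx, zero_mul]
        exact ⟨h3.self_of_nhds, by rw [h3.fderiv_eq]; simp⟩
    · intro p hp hpK
      have : R + 2 < quad b p := by
        by_contra h
        exact hpK ⟨le_of_lt hp.2, le_of_lt hp.1, not_lt.1 h⟩
      show X p * Cur l p = 0
      rw [(hX0 p this).self_of_nhds, zero_mul]
  have hG0 : ∫ p in Ω, ∑ l, pderiv l (fun p => X p * Cur l p) p = 0 := by
    rw [integral_finsetSum _ fun l _ => (hdiv l).1]
    exact Finset.sum_eq_zero fun l _ => (hdiv l).2
  have hGi : IntegrableOn (fun p => ∑ l, pderiv l (fun p => X p * Cur l p) p) Ω :=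
    integrable_finsetSum _ fun l _ => (hdiv l).1
  have hKi : IntegrableOn (K.indicator fun _ => (1 : ℝ)) Ω :=
    ((integrable_indicator_iff hK.measurableSet).2
      (continuous_const.continuousOn.integrableOn_compact hK)).integrableOn
  set D : Set (Spacetime d) := {p | quad b p ≤ R} with hD
  have hDm : MeasurableSet D := (isClosed_le hquad continuous_const).measurableSet
  have hDK : ∀ p ∈ Ω, p ∈ D → p ∈ K := fun p hp hpD =>
    ⟨le_of_lt hp.2, le_of_lt hp.1, le_trans hpD (by linarith)⟩
  have hDi : IntegrableOn (D.indicator U) Ω := by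
    have h1 : IntegrableOn (D.indicator (K.indicator U)) Ω :=
      (((integrable_indicator_iff hK.measurableSet).2
        (hUc.continuousOn.integrableOn_compact hK)).indicator hDm).integrableOn
    refine h1.congr_fun (fun p hp => ?_) hΩ.measurableSet
    by_cases hpD : p ∈ D
    · simp [hpD, hDK p hp hpD]
    · simp [hpD]
  -- The cutoff's derivatives live where f ≥ R + 1 and the weight is at most its value at level R +
  -- 1. The Carleman term is kept only on f ≤ R, where the weight is at least its value at level R.
  have hpt : ∀ p ∈ Ω, ∑ l, pderiv l (fun p => X p * Cur l p) p ≤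
      C₁ * (lam ^ 2 * Real.exp (-(lam * F (R + 1))) ^ 2) * K.indicator (fun _ => (1 : ℝ)) p
      - c * Real.exp (-(lam * F R)) ^ 2 * D.indicator U p := by
    intro p hp
    have hXd : DifferentiableAt ℝ X p := hXc.differentiable two_ne_zero p
    have e1 : ∑ l, pderiv l (fun p => X p * Cur l p) p
        = ∑ l, pderiv l X p * Cur l p + X p * ∑ j, ∑ l, pderiv l (current b (d - 1)
          (potential b lam) (conj b lam (u j)) l) p := by
      rw [Finset.sum_comm, Finset.mul_sum, ← Finset.sum_add_distrib]
      refine Finset.sum_congr rfl fun l _ => ?_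
      rw [pderiv_mul l hXd ((hCurc l).differentiable one_ne_zero p), hCur,
        pderiv_sum l _ fun j _ => (hcj j l).differentiable one_ne_zero p]
    rw [e1]
    have hcut : ∀ q : Spacetime d, 0 ≤ X q := fun q => Real.smoothTransition.nonneg _
    by_cases hpK : p ∈ K
    · rw [indicator_of_mem hpK, mul_one]
      have h1 : ∑ l, pderiv l X p * Cur l p ≤
          C₁ * (lam ^ 2 * Real.exp (-(lam * F (R + 1))) ^ 2) := by
        by_cases hpR : quad b p < R + 1
        · rw [Finset.sum_eq_zero fun l _ => by
            rw [hX, pderiv_cutoff_eq_zero b (Or.inl hpR), zero_mul]]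
          have : 0 ≤ C₁ := Finset.sum_nonneg fun l _ => hB0 l
          positivity
        · rw [hC₁, Finset.sum_mul]
          refine Finset.sum_le_sum fun l _ => (le_abs_self _).trans ((hB l lam hlam1 p hpK).trans ?_)
          refine mul_le_mul_of_nonneg_left (mul_le_mul_of_nonneg_left
            (pow_le_pow_left₀ (Real.exp_pos _).le (Real.exp_le_exp.2 ?_) 2) (sq_nonneg _)) (hB0 l)
          have h2 : F (R + 1) ≤ phase b p := hFmono _ _ (not_lt.1 hpR)
          have := mul_le_mul_of_nonneg_left h2 (by linarith : 0 ≤ lam)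
          linarith
      have h2 := mul_le_mul_of_nonneg_left (hL lam hlamL p ⟨hp.1, hpK⟩) (hcut p)
      have h3 : c * Real.exp (-(lam * F R)) ^ 2 * D.indicator U p ≤
          X p * (c * ∑ j, conj b lam (u j) p ^ 2) := by
        have e2 : ∑ j, conj b lam (u j) p ^ 2 = Real.exp (-(lam * phase b p)) ^ 2 * U p := by
          rw [hU, Finset.mul_sum]
          exact Finset.sum_congr rfl fun j _ => by rw [conj, mul_pow]
        rw [e2]
        by_cases hpD : p ∈ D
        · have hX1 : X p = 1 := cutoff_eq_one b (le_trans hpD (by linarith))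
          rw [indicator_of_mem hpD, hX1, one_mul, mul_assoc]
          refine mul_le_mul_of_nonneg_left (mul_le_mul_of_nonneg_right
            (pow_le_pow_left₀ (Real.exp_pos _).le (Real.exp_le_exp.2 ?_) 2) (hU0 p)) hc.le
          have h2 : phase b p ≤ F R := hFmono _ _ hpD
          have := mul_le_mul_of_nonneg_left h2 (by linarith : 0 ≤ lam)
          linarith
        · rw [indicator_of_notMem hpD, mul_zero]
          exact mul_nonneg (hcut p) (by have := hU0 p; positivity)
      linarith
    · have hpR : R + 2 < quad b p := by
        by_contra h
        exact hpK ⟨le_of_lt hp.2, le_of_lt hp.1, not_lt.1 h⟩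
      rw [indicator_of_notMem hpK, indicator_of_notMem (fun h => hpK (hDK p hp h)),
        (hX0 p hpR).self_of_nhds, Finset.sum_eq_zero fun l _ => by
            rw [hX, pderiv_cutoff_eq_zero b (Or.inr (by linarith)), zero_mul]]
      simp
  have hint := setIntegral_mono_on hGi ((hKi.const_mul _).sub (hDi.const_mul _)) hΩ.measurableSet hpt
  rw [hG0] at hint
  simp only [Pi.sub_apply] at hint
  rw [integral_sub (hKi.const_mul _) (hDi.const_mul _), integral_const_mul, integral_const_mul,
    ← hV] at hint
  have hexp : Real.exp (-(lam * F (R + 1))) ^ 2 = Real.exp (-(lam * F R)) ^ 2 *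
      Real.exp (-(2 * (1 / 3 * (Real.exp (-3 * R) - Real.exp (-3 * (R + 1)))) * lam)) := by
    rw [← Real.exp_nat_mul, ← Real.exp_nat_mul, ← Real.exp_add]
    congr 1
    simp only [hF]; push_cast; ring
  rw [hexp] at hint
  have hpos : 0 < Real.exp (-(lam * F R)) ^ 2 := by positivity
  rw [div_mul_eq_mul_div, le_div_iff₀ hc]
  refine le_of_mul_le_mul_left ?_ hpos
  linarith

/-- Uniqueness for the differential inequality, given that all first derivatives vanish on the
horizon. -/
theorem eq_zero_of_differential_inequality {ι : Type*} [Fintype ι] {u : ι → Spacetime d → ℝ}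
    (hu : ∀ j, ContDiff ℝ 2 (u j))
    (hu0 : ∀ p ∈ horizon d, ∀ j, u j p = 0 ∧ ∀ l, pderiv l (u j) p = 0)
    (hineq : ∀ K : Set (Spacetime d), IsCompact K → ∃ C ≥ 0, ∀ p ∈ exterior d, p ∈ K →
      ∑ j, box (u j) p ^ 2 ≤ C * ∑ j, (u j p ^ 2 + ∑ l, pderiv l (u j) p ^ 2))
    {p : Spacetime d} (hp : p ∈ exterior d) (j : ι) : u j p = 0 := by
  -- Here f(p) ≤ |x|² < R, |t| < T and R + 2 < 1 + 3T/2. The relation (a - 1)T = 1/2 fixes `a`, and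
  -- T ≥ 5 is more than enough for a ≤ 3/2.
  set T := ‖p.2‖ ^ 2 + 5 with hT
  set R := ‖p.2‖ ^ 2 + 1 with hR
  set a := 1 + 1 / (2 * T) with ha
  have hT5 : 5 ≤ T := by have := sq_nonneg ‖p.2‖; linarith
  have haT : (a - 1) * T = 1 / 2 := by rw [ha]; field_simp; ring
  have ha1 : 1 < a := by rw [ha]; have : 0 < 1 / (2 * T) := by positivity
                         linarith
  have ha2 : a ≤ 3 / 2 := by nlinarith
  obtain ⟨C₀, hC₀, hC₀'⟩ := hineq _ (isCompact_truncation (by linarith : 0 ≤ a) T (R + 2))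
  obtain ⟨C, L, hCL⟩ := exists_setIntegral_le ha1 ha2 haT (R := R)
    (by have := sq_nonneg ‖p.2‖; linarith) hu hu0 hC₀ hC₀'
  set D : Set (Spacetime d) := {p | quad (coef d a) p ≤ R} with hD
  set U : Spacetime d → ℝ := fun p => ∑ j, u j p ^ 2 with hU
  have hUc : Continuous U := continuous_finsetSum _ fun j _ => (hu j).continuous.pow 2
  have hU0 : ∀ p, 0 ≤ U p := fun p => Finset.sum_nonneg fun _ _ => sq_nonneg _
  set δ := 2 * (1 / 3 * (Real.exp (-3 * R) - Real.exp (-3 * (R + 1)))) with hδ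
  have hδpos : 0 < δ := by
    have : Real.exp (-3 * (R + 1)) < Real.exp (-3 * R) := Real.exp_lt_exp.2 (by linarith)
    rw [hδ]; linarith
  have hlim : Tendsto (fun lam : ℝ => C * (lam ^ 2 * Real.exp (-(δ * lam)))) atTop (𝓝 0) := by
    have h1 := (Real.tendsto_pow_mul_exp_neg_atTop_nhds_zero 2).comp
      (tendsto_id.const_mul_atTop hδpos)
    have h2 := h1.const_mul (C / δ ^ 2)
    rw [mul_zero] at h2
    refine h2.congr fun lam => ?_
    simp only [Function.comp_apply, id]
    field_simp
  have hI : ∫ p in slab d T, D.indicator U p ≤ 0 :=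
    ge_of_tendsto hlim ((eventually_ge_atTop L).mono hCL)
  have hquad : Continuous (quad (coef d a) : Spacetime d → ℝ) :=
    (contDiff_quad _ (n := 0)).continuous
  have hDm : MeasurableSet D := (isClosed_le hquad continuous_const).measurableSet
  have hK := isCompact_truncation (d := d) (by linarith : 0 ≤ a) T R
  have hi : IntegrableOn (D.indicator U) (slab d T) := by
    have h1 : IntegrableOn (D.indicator ((truncation d a T R).indicator U)) (slab d T) :=
      (((integrable_indicator_iff hK.measurableSet).2
        (hUc.continuousOn.integrableOn_compact hK)).indicator hDm).integrableOn
    refine h1.congr_fun (fun p hp => ?_) (isOpen_slab T).measurableSet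
    by_cases hpD : p ∈ D
    · have : p ∈ truncation d a T R := ⟨le_of_lt hp.2, le_of_lt hp.1, hpD⟩
      simp [hpD, this]
    · simp [hpD]
  have hnn : ∀ p, 0 ≤ D.indicator U p := fun p => indicator_nonneg (fun p _ => hU0 p) p
  have hz := (integral_eq_zero_iff_of_nonneg hnn hi).1 (le_antisymm hI (integral_nonneg hnn))
  set O : Set (Spacetime d) := slab d T ∩ {p | quad (coef d a) p < R} with hO
  have hOo : IsOpen O := (isOpen_slab T).inter (isOpen_lt hquad continuous_const)
  -- Vanishing almost everywhere becomes vanishing at every point on the open set f < R, by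
  -- continuity.
  have hae : U =ᵐ[volume.restrict O] fun _ => 0 := by
    have h1 := ae_restrict_of_ae_restrict_of_subset (inter_subset_left : O ⊆ slab d T) hz
    filter_upwards [h1, ae_restrict_mem hOo.measurableSet] with x hx hxO
    have : x ∈ D := le_of_lt (show quad (coef d a) x < R from hxO.2)
    simpa [this] using hx
  have hEq := Measure.eqOn_open_of_ae_eq hae hOo hUc.continuousOn continuousOn_const
  have hpO : p ∈ O := by
    have h0 : |p.1| + 1 < ‖p.2‖ := hp
    refine ⟨⟨hp, ?_⟩, ?_⟩
    · show |p.1| < T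
      nlinarith [sq_nonneg (‖p.2‖ - 1)]
    · show quad (coef d a) p < R
      rw [quad_coef]
      have : 0 ≤ a * p.1 ^ 2 := by positivity
      linarith
  have hUp : ∑ j, u j p ^ 2 = 0 := hEq hpO
  exact pow_eq_zero_iff two_ne_zero |>.1
    ((Finset.sum_eq_zero_iff_of_nonneg fun _ _ => sq_nonneg _).1 hUp j (Finset.mem_univ j))

/-! ### First derivatives on the horizon. -/

theorem fderiv_apply_eq_sum {f : Spacetime d → ℝ} (p v : Spacetime d) :
    fderiv ℝ f p v = v.1 * pderiv 0 f p + ∑ i : Fin d, v.2 i * pderiv i.succ f p := by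
  conv_lhs => rw [← sum_coord_smul_basisVec v]
  simp [map_sum, pderiv, Fin.sum_univ_succ]

/-- The graph parametrizations of the two halves of the horizon. -/
noncomputable def cone (σ : ℝ) (x : EuclideanSpace ℝ (Fin d)) : Spacetime d := (σ * (‖x‖ - 1), x)

theorem hasDerivAt_norm_line {x : EuclideanSpace ℝ (Fin d)} (hx : x ≠ 0) (i : Fin d) :
    HasDerivAt (fun t : ℝ => ‖x + t • EuclideanSpace.single i (1 : ℝ)‖) (x i / ‖x‖) 0 := by
  have h1 : HasDerivAt (fun t : ℝ => x + t • EuclideanSpace.single i (1 : ℝ))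
      (EuclideanSpace.single i (1 : ℝ)) 0 := by
    simpa using ((hasDerivAt_id (0 : ℝ)).smul_const (EuclideanSpace.single i (1 : ℝ))).const_add x
  have h2 := h1.norm_sq.sqrt (by simpa using hx)
  simp only [Real.sqrt_sq (norm_nonneg _), zero_smul, add_zero] at h2
  convert! h2 using 1
  simp [EuclideanSpace.inner_single_right]
  field_simp

theorem hasDerivAt_comp_cone (σ : ℝ) {f : Spacetime d → ℝ} (hf : Differentiable ℝ f)
    {x : EuclideanSpace ℝ (Fin d)} (hx : x ≠ 0) (i : Fin d) :
    HasDerivAt (fun t : ℝ => f (cone σ (x + t • EuclideanSpace.single i (1 : ℝ))))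
      (σ * (x i / ‖x‖) * pderiv 0 f (cone σ x) + pderiv i.succ f (cone σ x)) 0 := by
  have h1 : HasDerivAt (fun t : ℝ => x + t • EuclideanSpace.single i (1 : ℝ))
      (EuclideanSpace.single i (1 : ℝ)) 0 := by
    simpa using ((hasDerivAt_id (0 : ℝ)).smul_const (EuclideanSpace.single i (1 : ℝ))).const_add x
  have h2 : HasDerivAt (fun t : ℝ => cone σ (x + t • EuclideanSpace.single i (1 : ℝ)))
      (σ * (x i / ‖x‖), EuclideanSpace.single i (1 : ℝ)) 0 :=
    (((hasDerivAt_norm_line hx i).sub_const 1).const_mul σ).prodMk h1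
  have h3 := ((hf (cone σ (x + (0 : ℝ) • EuclideanSpace.single i (1 : ℝ)))).hasFDerivAt).comp_hasDerivAt
    (0 : ℝ) h2
  convert! h3 using 1
  rw [fderiv_apply_eq_sum]
  simp

theorem eventually_one_lt_norm {x : EuclideanSpace ℝ (Fin d)} (hx : 1 < ‖x‖)
    (v : EuclideanSpace ℝ (Fin d)) : ∀ᶠ t : ℝ in 𝓝 0, 1 < ‖x + t • v‖ := by
  have : Continuous fun t : ℝ => ‖x + t • v‖ := by fun_prop
  exact this.continuousAt.eventually_const_lt (by simpa using hx)

theorem cone_mem_horizon {σ : ℝ} (hσ : |σ| = 1) {x : EuclideanSpace ℝ (Fin d)} (hx : 1 ≤ ‖x‖) :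
    cone σ x ∈ horizon d := by
  show ‖x‖ = |σ * (‖x‖ - 1)| + 1
  rw [abs_mul, hσ, abs_of_nonneg (by linarith)]; ring

/-- The composite of `u` with the graph `cone σ` is zero near `x`; this is its i-th partial
derivative, cleared of the denominator |x|. -/
theorem tangential_eq_zero {σ : ℝ} (hσ : |σ| = 1) {u : Spacetime d → ℝ} (hu : Differentiable ℝ u)
    (hu0 : ∀ p ∈ horizon d, u p = 0) {x : EuclideanSpace ℝ (Fin d)} (hx : 1 < ‖x‖) (i : Fin d) :
    ‖x‖ * pderiv i.succ u (cone σ x) + σ * x i * pderiv 0 u (cone σ x) = 0 := by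
  have hx0 : x ≠ 0 := by rintro rfl; simp at hx; linarith
  have hr : ‖x‖ ≠ 0 := norm_ne_zero_iff.2 hx0
  have h1 := hasDerivAt_comp_cone σ hu hx0 i
  have h2 : (fun t : ℝ => u (cone σ (x + t • EuclideanSpace.single i (1 : ℝ)))) =ᶠ[𝓝 0]
      fun _ => 0 := by
    filter_upwards [eventually_one_lt_norm hx (EuclideanSpace.single i (1 : ℝ))] with t ht
    exact hu0 _ (cone_mem_horizon hσ ht.le)
  have h3 := h1.unique ((hasDerivAt_const (0 : ℝ) (0 : ℝ)).congr_of_eventuallyEq h2)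
  field_simp at h3
  linarith

/-- The wave operator on the horizon is a transport operator for the time derivative. -/
theorem box_eq_transport {σ : ℝ} (hσ : |σ| = 1) {u : Spacetime d → ℝ} (hu : ContDiff ℝ 2 u)
    (hu0 : ∀ p ∈ horizon d, u p = 0) {x : EuclideanSpace ℝ (Fin d)} (hx : 1 < ‖x‖) :
    ‖x‖ * box u (cone σ x) + 2 * (‖x‖ * pderiv 0 (pderiv 0 u) (cone σ x)
      + σ * ∑ i : Fin d, x i * pderiv i.succ (pderiv 0 u) (cone σ x))
      + σ * (d - 1) * pderiv 0 u (cone σ x) = 0 := by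
  have hx0 : x ≠ 0 := by rintro rfl; simp at hx; linarith
  have hr : ‖x‖ ≠ 0 := norm_ne_zero_iff.2 hx0
  have hσ2 : σ ^ 2 = 1 := by rw [← sq_abs, hσ]; norm_num
  have hud : Differentiable ℝ u := hu.differentiable two_ne_zero
  have hg : ∀ k, Differentiable ℝ (pderiv k u) := fun k =>
    (contDiff_pderiv hu (m := 1) (by norm_num) k).differentiable one_ne_zero
  have htan := fun i => tangential_eq_zero hσ hud hu0 hx i
  set p := cone σ x
  -- The tangential relation differentiated once more in the same tangential direction, multiplied
  -- by |x|². Summed over i, it turns the pure second derivatives into the Laplacian.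
  have key : ∀ i : Fin d, x i * (‖x‖ * pderiv i.succ u p) + ‖x‖ * (2 * (σ * (x i *
      pderiv i.succ (pderiv 0 u) p))) * ‖x‖ + ‖x‖ ^ 3 * pderiv i.succ (pderiv i.succ u) p
      + ‖x‖ ^ 2 * (σ * pderiv 0 u p) + ‖x‖ * (x i ^ 2 * pderiv 0 (pderiv 0 u) p) = 0 := by
    intro i
    have h1 := (hasDerivAt_norm_line hx0 i).mul (hasDerivAt_comp_cone σ (hg i.succ) hx0 i)
    have hxi : HasDerivAt (fun t : ℝ => σ * (x + t • EuclideanSpace.single i (1 : ℝ)) i) σ 0 := by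
      have : HasDerivAt (fun t : ℝ => σ * (x i + t)) σ 0 := by
        simpa using ((hasDerivAt_id (0 : ℝ)).const_add (x i)).const_mul σ
      simpa using this
    have h2 := h1.add (hxi.mul (hasDerivAt_comp_cone σ (hg 0) hx0 i))
    have h3 : ∀ᶠ t : ℝ in 𝓝 0, ‖x + t • EuclideanSpace.single i (1 : ℝ)‖ * pderiv i.succ u
        (cone σ (x + t • EuclideanSpace.single i (1 : ℝ))) +
        σ * (x + t • EuclideanSpace.single i (1 : ℝ)) i *
          pderiv 0 u (cone σ (x + t • EuclideanSpace.single i (1 : ℝ))) = 0 := by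
      filter_upwards [eventually_one_lt_norm hx (EuclideanSpace.single i (1 : ℝ))] with t ht
      exact tangential_eq_zero hσ hud hu0 ht i
    have h4 := h2.unique ((hasDerivAt_const (0 : ℝ) (0 : ℝ)).congr_of_eventuallyEq h3)
    simp only [zero_smul, add_zero] at h4
    rw [pderiv_comm hu 0 i.succ] at h4
    change x i / ‖x‖ * pderiv i.succ u p + ‖x‖ * (σ * (x i / ‖x‖) * pderiv i.succ (pderiv 0 u) p
      + pderiv i.succ (pderiv i.succ u) p) + (σ * pderiv 0 u p + σ * x i * (σ * (x i / ‖x‖) *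
        pderiv 0 (pderiv 0 u) p + pderiv i.succ (pderiv 0 u) p)) = 0 at h4
    field_simp at h4
    linear_combination ‖x‖ * h4 - ‖x‖ * (x i ^ 2 * pderiv 0 (pderiv 0 u) p) * hσ2
  have hsum := Finset.sum_eq_zero fun i (_ : i ∈ Finset.univ) => key i
  simp only [Finset.sum_add_distrib, ← Finset.mul_sum, ← Finset.sum_mul, ← norm_sq_eq_sum,
    Finset.sum_const, Finset.card_univ, Fintype.card_fin, nsmul_eq_mul] at hsum
  have ht : ∑ i, x i * (‖x‖ * pderiv i.succ u p) = -(σ * ‖x‖ ^ 2 * pderiv 0 u p) := by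
    have : ∀ i, x i * (‖x‖ * pderiv i.succ u p) = x i ^ 2 * (-(σ * pderiv 0 u p)) := fun i => by
      linear_combination (x i) * htan i
    rw [Finset.sum_congr rfl fun i _ => this i, ← Finset.sum_mul, ← norm_sq_eq_sum]; ring
  rw [ht] at hsum
  have hfin : ‖x‖ ^ 2 * (‖x‖ * box u p + 2 * (‖x‖ * pderiv 0 (pderiv 0 u) p
      + σ * ∑ i : Fin d, x i * pderiv i.succ (pderiv 0 u) p)
      + σ * (d - 1) * pderiv 0 u p) = 0 := by
    rw [box]
    linear_combination hsum
  exact (mul_eq_zero.1 hfin).resolve_left (pow_ne_zero 2 hr)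

/-- A null generator of the horizon. -/
noncomputable def ray (σ : ℝ) (ω : EuclideanSpace ℝ (Fin d)) (s : ℝ) : Spacetime d :=
  (σ * s, (1 + s) • ω)

section ray

variable {σ : ℝ} {ω : EuclideanSpace ℝ (Fin d)}

theorem continuous_ray : Continuous (ray σ ω) := by unfold ray; fun_prop

theorem norm_ray (hω : ‖ω‖ = 1) {s : ℝ} (hs : 0 ≤ s) : ‖(1 + s) • ω‖ = 1 + s := by
  rw [norm_smul, hω, mul_one, Real.norm_of_nonneg (by linarith)]

theorem cone_smul (hω : ‖ω‖ = 1) {s : ℝ} (hs : 0 ≤ s) : cone σ ((1 + s) • ω) = ray σ ω s := by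
  rw [cone, norm_ray hω hs, ray]; simp

/-- Serves to extend relations along a generator to its corner s = 0, where the graph `cone σ` does
not stay in the horizon nearby. -/
theorem eq_zero_of_nonneg {F : ℝ → ℝ} (hF : Continuous F) (h : ∀ s > 0, F s = 0) {s : ℝ}
    (hs : 0 ≤ s) : F s = 0 := by
  have h1 : Ioi (0 : ℝ) ⊆ {s | F s = 0} := fun s hs => h s hs
  have h2 := closure_minimal h1 (isClosed_eq hF continuous_const)
  rw [closure_Ioi] at h2
  exact h2 hs

theorem tangential_ray (hσ : |σ| = 1) (hω : ‖ω‖ = 1) {u : Spacetime d → ℝ} (hu : ContDiff ℝ 2 u)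
    (hu0 : ∀ p ∈ horizon d, u p = 0) (i : Fin d) {s : ℝ} (hs : 0 ≤ s) :
    pderiv i.succ u (ray σ ω s) = -(σ * ω i * pderiv 0 u (ray σ ω s)) := by
  have h1 := (continuous_pderiv hu i.succ).comp (continuous_ray (σ := σ) (ω := ω))
  have h2 := (continuous_pderiv hu 0).comp (continuous_ray (σ := σ) (ω := ω))
  simp only [Function.comp_def] at h1 h2
  have := eq_zero_of_nonneg (F := fun s => pderiv i.succ u (ray σ ω s)
    + σ * ω i * pderiv 0 u (ray σ ω s)) (by fun_prop) (fun s hs => ?_) hs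
  · linarith
  have h3 := tangential_eq_zero hσ (hu.differentiable two_ne_zero) hu0
    (x := (1 + s) • ω) (by rw [norm_ray hω hs.le]; linarith) i
  rw [norm_ray hω hs.le, cone_smul hω hs.le] at h3
  have h4 : (1 + s) ≠ 0 := by linarith
  simp only [PiLp.smul_apply, smul_eq_mul] at h3
  refine (mul_eq_zero.1 (?_ : (1 + s) * _ = 0)).resolve_left h4
  linear_combination h3

theorem transport_ray (hσ : |σ| = 1) (hω : ‖ω‖ = 1) {u : Spacetime d → ℝ} (hu : ContDiff ℝ 2 u)
    (hu0 : ∀ p ∈ horizon d, u p = 0) {s : ℝ} (hs : 0 ≤ s) :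
    (1 + s) * box u (ray σ ω s) + 2 * (1 + s) * (pderiv 0 (pderiv 0 u) (ray σ ω s)
      + σ * ∑ i : Fin d, ω i * pderiv i.succ (pderiv 0 u) (ray σ ω s))
      + σ * (d - 1) * pderiv 0 u (ray σ ω s) = 0 := by
  have hc := continuous_ray (σ := σ) (ω := ω)
  have h0 := (continuous_box hu).comp hc
  have h1 := (continuous_pderiv hu 0).comp hc
  have h2 : ∀ k, Continuous fun s => pderiv k (pderiv 0 u) (ray σ ω s) := fun k =>
    (contDiff_pderiv (contDiff_pderiv hu (m := 1) (by norm_num) 0) (m := 0)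
      (by norm_num) k).continuous.comp hc
  simp only [Function.comp_def] at h0 h1
  refine eq_zero_of_nonneg (F := fun s => (1 + s) * box u (ray σ ω s) + 2 * (1 + s) *
    (pderiv 0 (pderiv 0 u) (ray σ ω s) + σ * ∑ i : Fin d, ω i * pderiv i.succ (pderiv 0 u)
    (ray σ ω s)) + σ * (d - 1) * pderiv 0 u (ray σ ω s)) (by fun_prop) (fun s hs => ?_) hs
  have h3 := box_eq_transport hσ hu hu0
    (x := (1 + s) • ω) (by rw [norm_ray hω hs.le]; linarith)
  rw [norm_ray hω hs.le, cone_smul hω hs.le] at h3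
  simp only [PiLp.smul_apply, smul_eq_mul, mul_assoc, ← Finset.mul_sum] at h3 ⊢
  linear_combination h3

theorem hasDerivAt_comp_ray {f : Spacetime d → ℝ} (hf : Differentiable ℝ f) (s : ℝ) :
    HasDerivAt (fun s => f (ray σ ω s)) (σ * pderiv 0 f (ray σ ω s)
      + ∑ i : Fin d, ω i * pderiv i.succ f (ray σ ω s)) s := by
  have h1 : HasDerivAt (ray σ ω) (σ, ω) s := by
    have e1 : HasDerivAt (fun s : ℝ => σ * s) σ s := by simpa using (hasDerivAt_id s).const_mul σ
    have e2 : HasDerivAt (fun s : ℝ => (1 + s) • ω) ω s := by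
      simpa using ((hasDerivAt_id s).const_add 1).smul_const ω
    exact e1.prodMk e2
  have := (hf (ray σ ω s)).hasFDerivAt.comp_hasDerivAt s h1
  rwa [fderiv_apply_eq_sum] at this

theorem sum_sq_eq_one (hω : ‖ω‖ = 1) : ∑ i, ω i ^ 2 = 1 := by
  rw [← norm_sq_eq_sum, hω]; norm_num

/-- The generators for σ = 1 and σ = -1 meet at the corner and give ∂_i u = -ω_i ∂_t u and ∂_i u =
ω_i ∂_t u. Hence ω_i ∂_t u = 0 for all i, while ω ≠ 0. -/
theorem pderiv_corner (hω : ‖ω‖ = 1) {u : Spacetime d → ℝ} (hu : ContDiff ℝ 2 u)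
    (hu0 : ∀ p ∈ horizon d, u p = 0) : pderiv 0 u (ray σ ω 0) = 0 := by
  have e : ∀ σ : ℝ, ray σ ω 0 = (0, ω) := fun σ => by simp [ray]
  rw [e]
  have h : ∀ i, ω i * pderiv 0 u (0, ω) = 0 := by
    intro i
    have h1 := tangential_ray (σ := 1) (by simp) hω hu hu0 i le_rfl
    have h2 := tangential_ray (σ := -1) (by simp) hω hu hu0 i le_rfl
    rw [e] at h1 h2
    linarith
  calc pderiv 0 u (0, ω) = (∑ i, ω i ^ 2) * pderiv 0 u (0, ω) := by rw [sum_sq_eq_one hω, one_mul]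
    _ = ∑ i, ω i * (ω i * pderiv 0 u (0, ω)) := by
      rw [Finset.sum_mul]; exact Finset.sum_congr rfl fun i _ => by ring
    _ = 0 := by simp [h]

end ray

/-- The differential inequality and the vanishing on the horizon force the first derivatives to
vanish on the horizon. -/
theorem pderiv_eq_zero_of_mem_horizon (hd : 1 ≤ d) {ι : Type*} [Fintype ι]
    {u : ι → Spacetime d → ℝ} (hu : ∀ j, ContDiff ℝ 2 (u j))
    (hu0 : ∀ p ∈ horizon d, ∀ j, u j p = 0)
    (hineq : ∀ K : Set (Spacetime d), IsCompact K → ∃ C ≥ 0, ∀ p ∈ exterior d, p ∈ K →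
      ∑ j, box (u j) p ^ 2 ≤ C * ∑ j, (u j p ^ 2 + ∑ l, pderiv l (u j) p ^ 2))
    {p : Spacetime d} (hp : p ∈ horizon d) (j : ι) (l : Fin (d + 1)) : pderiv l (u j) p = 0 := by
  have hp' : ‖p.2‖ = |p.1| + 1 := hp
  obtain ⟨σ, hσ, hσp⟩ : ∃ σ : ℝ, |σ| = 1 ∧ p.1 = σ * |p.1| := by
    rcases le_total 0 p.1 with h | h
    · exact ⟨1, by simp, by rw [abs_of_nonneg h, one_mul]⟩
    · exact ⟨-1, by simp, by rw [abs_of_nonpos h]; ring⟩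
  set S := |p.1| with hS
  have hS0 : 0 ≤ S := abs_nonneg _
  set ω := (1 + S)⁻¹ • p.2 with hωdef
  have hω : ‖ω‖ = 1 := by
    rw [hωdef, norm_smul, hp', Real.norm_of_nonneg (by positivity)]; field_simp; ring
  have hpr : p = ray σ ω S := by
    refine Prod.ext hσp ?_
    simp only [ray, hωdef]
    rw [smul_smul, mul_inv_cancel₀ (by positivity), one_smul]
  have hu0' := fun j p hp => hu0 p hp j
  -- Radius S + 2 covers the generator up to p together with the unit radial segments leading from
  -- it into the exterior.
  set K : Set (Spacetime d) := Metric.closedBall 0 (S + 2) with hK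
  obtain ⟨C, hC, hCK⟩ := hineq K (isCompact_closedBall _ _)
  -- The inequality is known only in the exterior, so it is carried to the horizon by a radial
  -- limit. There u = 0 and ∂_i u = -σω_i ∂_t u, so the sum of squares is 2(∂_t u)².
  have hbox : ∀ s ∈ Icc 0 S, ∑ j, box (u j) (ray σ ω s) ^ 2
      ≤ 2 * C * ∑ j, pderiv 0 (u j) (ray σ ω s) ^ 2 := by
    intro s hs
    have hray : ray σ ω s ∈ horizon d := by
      rw [← cone_smul hω hs.1]
      exact cone_mem_horizon hσ (by rw [norm_ray hω hs.1]; linarith [hs.1])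
    have h1 : ∑ j, (u j (ray σ ω s) ^ 2 + ∑ l, pderiv l (u j) (ray σ ω s) ^ 2)
        = 2 * ∑ j, pderiv 0 (u j) (ray σ ω s) ^ 2 := by
      rw [Finset.mul_sum]
      refine Finset.sum_congr rfl fun j _ => ?_
      rw [hu0 _ hray, Fin.sum_univ_succ]
      simp_rw [tangential_ray hσ hω (hu j) (hu0' j) _ hs.1, neg_sq, mul_pow, ← sq_abs σ, hσ]
      simp_rw [one_pow, one_mul, ← Finset.sum_mul, sum_sq_eq_one hω]
      ring
    have h2 : Continuous fun e : ℝ => ((σ * s, (1 + s + e) • ω) : Spacetime d) := by fun_prop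
    have hLc : Continuous fun e : ℝ => ∑ j, box (u j) (σ * s, (1 + s + e) • ω) ^ 2 :=
      continuous_finsetSum _ fun j _ => ((continuous_box (hu j)).comp h2).pow 2
    have hRc : Continuous fun e : ℝ => C * ∑ j, (u j (σ * s, (1 + s + e) • ω) ^ 2
        + ∑ l, pderiv l (u j) (σ * s, (1 + s + e) • ω) ^ 2) :=
      continuous_const.mul (continuous_finsetSum _ fun j _ =>
        (((hu j).continuous.comp h2).pow 2).add
          (continuous_finsetSum _ fun l _ => ((continuous_pderiv (hu j) l).comp h2).pow 2))
    have h3 : Ioo (0 : ℝ) 1 ⊆ {e | ∑ j, box (u j) (σ * s, (1 + s + e) • ω) ^ 2 ≤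
        C * ∑ j, (u j (σ * s, (1 + s + e) • ω) ^ 2
        + ∑ l, pderiv l (u j) (σ * s, (1 + s + e) • ω) ^ 2)} := by
      intro e he
      have hn : ‖(1 + s + e) • ω‖ = 1 + s + e := by
        rw [norm_smul, hω, mul_one, Real.norm_of_nonneg (by linarith [hs.1, he.1])]
      have ha : |σ * s| = s := by rw [abs_mul, hσ, one_mul, abs_of_nonneg hs.1]
      refine hCK _ ?_ ?_
      · show |σ * s| + 1 < ‖(1 + s + e) • ω‖
        rw [hn, ha]; linarith [he.1]
      · rw [hK, mem_closedBall_zero_iff, Prod.norm_def]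
        refine max_le ?_ ?_
        · rw [Real.norm_eq_abs, ha]; linarith [hs.2]
        · rw [hn]; linarith [hs.2, he.2]
    have h4 := closure_minimal h3 (isClosed_le hLc hRc)
    rw [closure_Ioo (by norm_num)] at h4
    have h5 := h4 (show (0 : ℝ) ∈ Icc (0 : ℝ) 1 by simp)
    simp only [mem_ofPred_eq, add_zero] at h5
    refine h5.trans ?_
    have h6 : (σ * s, (1 + s) • ω) = ray σ ω s := rfl
    rw [h6, h1]; linarith
  let g : ℝ → ι → ℝ := fun s j => pderiv 0 (u j) (ray σ ω s)
  let g' : ℝ → ι → ℝ := fun s j => σ * pderiv 0 (pderiv 0 (u j)) (ray σ ω s)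
      + ∑ i : Fin d, ω i * pderiv i.succ (pderiv 0 (u j)) (ray σ ω s)
  have hg : ∀ s, HasDerivAt g (g' s) s := fun s => hasDerivAt_pi.2 fun j =>
    hasDerivAt_comp_ray ((contDiff_pderiv (hu j) (m := 1) (by norm_num) 0).differentiable
      one_ne_zero) s
  -- Gronwall from the corner. The square root bounds □u in the sup norm over components, and `d`
  -- bounds the coefficient d - 1 of the transport law.
  have hgz := eq_zero_of_abs_deriv_le_mul_abs_self_of_eq_zero_right
    (K := Real.sqrt (2 * C * Fintype.card ι) + d) (f := g) (f' := g') (a := 0) (b := S)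
    (fun s _ => (hg s).continuousAt.continuousWithinAt)
    (fun s _ => (hg s).hasDerivWithinAt)
    (funext fun j => pderiv_corner hω (hu j) (hu0' j)) (fun s hs => ?_) S ⟨hS0, le_rfl⟩
  · have h0 : pderiv 0 (u j) p = 0 := by rw [hpr]; exact congrFun hgz j
    refine Fin.cases h0 (fun i => ?_) l
    rw [hpr, tangential_ray hσ hω (hu j) (hu0' j) i hS0, ← hpr, h0]; ring
  have hnn : 0 ≤ ‖g s‖ := norm_nonneg _
  rw [pi_norm_le_iff_of_nonneg (by positivity)]
  intro k
  have hσ2 : σ ^ 2 = 1 := by rw [← sq_abs, hσ]; norm_num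
  have hs1 : 0 < 1 + s := by linarith [hs.1]
  have ht := transport_ray hσ hω (hu k) (hu0' k) hs.1
  have hgk : |g s k| ≤ ‖g s‖ := norm_le_pi_norm (g s) k
  have hb : |box (u k) (ray σ ω s)| ≤ Real.sqrt (2 * C * Fintype.card ι) * ‖g s‖ := by
    rw [← Real.sqrt_sq hnn, ← Real.sqrt_mul (by positivity)]
    refine Real.abs_le_sqrt ?_
    have h1 := Finset.single_le_sum (f := fun k => box (u k) (ray σ ω s) ^ 2)
      (fun _ _ => sq_nonneg _) (Finset.mem_univ k)
    have h2 : ∑ j, pderiv 0 (u j) (ray σ ω s) ^ 2 ≤ Fintype.card ι * ‖g s‖ ^ 2 := by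
      rw [← nsmul_eq_mul, ← Finset.card_univ]
      refine Finset.sum_le_card_nsmul _ _ _ fun j _ => ?_
      rw [← sq_abs]
      exact pow_le_pow_left₀ (abs_nonneg _) (norm_le_pi_norm (g s) j) 2
    refine h1.trans ((hbox s ⟨hs.1, hs.2.le⟩).trans ?_)
    rw [mul_assoc _ (Fintype.card ι : ℝ)]
    exact mul_le_mul_of_nonneg_left h2 (by positivity)
  have he : 2 * (1 + s) * g' s k
      = -(σ * (1 + s) * box (u k) (ray σ ω s)) - (d - 1) * g s k := by
    simp only [g, g']
    linear_combination σ * ht - (2 * (1 + s) * ∑ i : Fin d, ω i * pderiv i.succ (pderiv 0 (u k))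
      (ray σ ω s) + (d - 1) * pderiv 0 (u k) (ray σ ω s)) * hσ2
  have hd1 : (1 : ℝ) ≤ d := by exact_mod_cast hd
  have habs : 2 * (1 + s) * |g' s k| ≤ (1 + s) * |box (u k) (ray σ ω s)| + (d - 1) * |g s k| := by
    calc 2 * (1 + s) * |g' s k| = |2 * (1 + s) * g' s k| := by
          rw [abs_mul, abs_of_pos (by positivity : 0 < 2 * (1 + s))]
      _ ≤ |σ * (1 + s) * box (u k) (ray σ ω s)| + |(d - 1) * g s k| := by
          rw [he]
          exact (abs_sub _ _).trans (by rw [abs_neg])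
      _ = _ := by
          rw [abs_mul, abs_mul, hσ, abs_mul, abs_of_pos hs1,
            abs_of_nonneg (by linarith : (0 : ℝ) ≤ d - 1), one_mul]
  rw [Real.norm_eq_abs]
  have hk0 := abs_nonneg (g' s k)
  have hg0 := abs_nonneg (g s k)
  have hX : 0 ≤ Real.sqrt (2 * C * Fintype.card ι) * ‖g s‖ := by positivity
  have h7 : (d - 1) * |g s k| ≤ (1 + s) * (d * ‖g s‖) := by
    have e1 : (d - 1) * |g s k| ≤ d * ‖g s‖ :=
      mul_le_mul (by linarith) hgk hg0 (by linarith)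
    have e2 : 0 ≤ s * (d * ‖g s‖) := mul_nonneg hs.1 (by positivity)
    linarith
  have h8 := mul_le_mul_of_nonneg_left hb hs1.le
  refine le_of_mul_le_mul_left (?_ : (1 + s) * _ ≤ (1 + s) * _) hs1
  have h9 : 0 ≤ (1 + s) * |g' s k| := by positivity
  linarith

/-! ### Reduction to a real system. -/

variable {𝕜 : Type*} [RCLike 𝕜]

theorem pderiv_clm_comp (L : 𝕜 →L[ℝ] ℝ) {f : Spacetime d → 𝕜} (hf : Differentiable ℝ f)
    (l : Fin (d + 1)) : pderiv l (fun p => L (f p)) = fun p => L (pderiv l f p) := by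
  funext p
  have := (L.hasFDerivAt.comp p (hf p).hasFDerivAt).fderiv
  simp only [Function.comp_def] at this
  simp [pderiv, this]

theorem box_clm_comp (L : 𝕜 →L[ℝ] ℝ) {f : Spacetime d → 𝕜} (hf : ContDiff ℝ 2 f)
    (p : Spacetime d) : box (fun p => L (f p)) p = L (box f p) := by
  have h : ∀ l, pderiv l (pderiv l fun p => L (f p)) p = L (pderiv l (pderiv l f) p) := by
    intro l
    rw [pderiv_clm_comp L (hf.differentiable two_ne_zero), pderiv_clm_comp L
      ((contDiff_pderiv hf (m := 1) (by norm_num) l).differentiable one_ne_zero)]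
  simp [box, h, map_sum]

/-- The real and imaginary parts. -/
noncomputable def part (j : Bool) : 𝕜 →L[ℝ] ℝ := cond j RCLike.reCLM RCLike.imCLM

theorem sum_part_sq (z : 𝕜) : ∑ j, part j z ^ 2 = ‖z‖ ^ 2 := by
  rw [← RCLike.normSq_eq_def', RCLike.normSq_apply]
  simp [part]; ring

theorem norm_sq_add_sum_le {n : ℕ} (a x : 𝕜) (b y : Fin n → 𝕜) :
    ‖a * x + ∑ l, b l * y l‖ ^ 2 ≤
      2 * (‖a‖ ^ 2 + ∑ l, ‖b l‖ ^ 2) * (‖x‖ ^ 2 + ∑ l, ‖y l‖ ^ 2) := by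
  have h1 : ‖a * x + ∑ l, b l * y l‖ ≤ ‖a‖ * ‖x‖ + ∑ l, ‖b l‖ * ‖y l‖ := by
    refine (norm_add_le _ _).trans (add_le_add (norm_mul _ _).le ((norm_sum_le _ _).trans ?_))
    exact Finset.sum_le_sum fun l _ => (norm_mul _ _).le
  have h2 := Finset.sum_mul_sq_le_sq_mul_sq Finset.univ (fun l => ‖b l‖) (fun l => ‖y l‖)
  have hb : 0 ≤ ∑ l, ‖b l‖ ^ 2 := Finset.sum_nonneg fun _ _ => sq_nonneg _
  have hy : 0 ≤ ∑ l, ‖y l‖ ^ 2 := Finset.sum_nonneg fun _ _ => sq_nonneg _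
  refine (pow_le_pow_left₀ (norm_nonneg _) h1 2).trans (add_sq_le.trans ?_)
  rw [mul_pow]
  have e1 : 0 ≤ ‖a‖ ^ 2 * ∑ l, ‖y l‖ ^ 2 := by positivity
  have e2 : 0 ≤ (∑ l, ‖b l‖ ^ 2) * ‖x‖ ^ 2 := by positivity
  linarith

end Minkowski

theorem theorem1p1 {𝕜 : Type*} [RCLike 𝕜] (d : ℕ) (hd : 1 ≤ d)
    (φ A : Minkowski.Spacetime d → 𝕜)
    (B : Fin (d + 1) → Minkowski.Spacetime d → 𝕜)
    (hφ : ContDiff ℝ 2 φ)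
    (hA : Continuous A)
    (hB : ∀ l, Continuous (B l))
    (heq : ∀ p ∈ Minkowski.exterior d,
      Minkowski.box φ p = A p * φ p + ∑ l : Fin (d + 1), B l p * Minkowski.pderiv l φ p)
    (hzero : ∀ p ∈ Minkowski.horizon d, φ p = 0) :
    ∀ p ∈ closure (Minkowski.exterior d), φ p = 0 := by
  -- Complex coefficients couple the real and imaginary parts, so they are treated as one
  -- two-component real system.
  let u : Bool → Minkowski.Spacetime d → ℝ := fun j p => Minkowski.part j (φ p)
  have hφd : Differentiable ℝ φ := hφ.differentiable two_ne_zero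
  have hu : ∀ j, ContDiff ℝ 2 (u j) := fun j => (Minkowski.part (𝕜 := 𝕜) j).contDiff.comp hφ
  have hu0 : ∀ p ∈ Minkowski.horizon d, ∀ j, u j p = 0 := fun p hp j => by
    simp only [u, hzero p hp, map_zero]
  have hineq : ∀ K : Set (Minkowski.Spacetime d), IsCompact K → ∃ C ≥ 0,
      ∀ p ∈ Minkowski.exterior d, p ∈ K → ∑ j, Minkowski.box (u j) p ^ 2 ≤
        C * ∑ j, (u j p ^ 2 + ∑ l, Minkowski.pderiv l (u j) p ^ 2) := by
    intro K hK
    obtain ⟨C, hC⟩ := hK.exists_bound_of_continuousOn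
      (f := fun p => ‖A p‖ ^ 2 + ∑ l, ‖B l p‖ ^ 2)
      ((hA.norm.pow 2).add (continuous_finsetSum _ fun l _ => (hB l).norm.pow 2)).continuousOn
    refine ⟨2 * |C|, by positivity, fun p hp hpK => ?_⟩
    have h1 : ∑ j, Minkowski.box (u j) p ^ 2 = ‖Minkowski.box φ p‖ ^ 2 := by
      simp only [u, Minkowski.box_clm_comp _ hφ, Minkowski.sum_part_sq]
    have h2 : ∑ j, (u j p ^ 2 + ∑ l, Minkowski.pderiv l (u j) p ^ 2)
        = ‖φ p‖ ^ 2 + ∑ l, ‖Minkowski.pderiv l φ p‖ ^ 2 := by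
      rw [Finset.sum_add_distrib, Finset.sum_comm]
      simp only [u, Minkowski.pderiv_clm_comp _ hφd, Minkowski.sum_part_sq]
    rw [h1, h2, heq p hp]
    refine (Minkowski.norm_sq_add_sum_le _ _ _ _).trans (mul_le_mul_of_nonneg_right ?_ ?_)
    · have := (le_abs_self _).trans (hC p hpK)
      linarith [le_abs_self C]
    · exact add_nonneg (sq_nonneg _) (Finset.sum_nonneg fun _ _ => sq_nonneg _)
  have hext : ∀ p ∈ Minkowski.exterior d, φ p = 0 := by
    intro p hp
    have h := Minkowski.eq_zero_of_differential_inequality hu (fun p hp j =>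
      ⟨hu0 p hp j, Minkowski.pderiv_eq_zero_of_mem_horizon hd hu hu0 hineq hp j⟩) hineq hp
    have h2 := Minkowski.sum_part_sq (φ p)
    rw [Finset.sum_eq_zero fun j _ => by rw [show Minkowski.part j (φ p) = 0 from h j]; norm_num]
      at h2
    exact norm_eq_zero.1 (pow_eq_zero_iff two_ne_zero |>.1 h2.symm)
  exact fun p hp => closure_minimal hext (isClosed_eq hφ.continuous continuous_const) hp
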